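/- Let $\Sigma\subset\mathbb{R}^n$ be a complete smooth fan (with respect to the lattice $\mathbb{Z}^n$) that carries a strictly convex piecewise linear function with integral slopes, i.e. the fan of an $n$-dimensional projective toric manifold. Let $\Sigma(1)=\{\rho_1,\dots,\rho_d\}$ be its set of rays. A subset $\mathcal{P}\subset\Sigma(1)$ is a primitive collection if it is not contained in any cone of $\Sigma$ but every proper subset of it is. Let $$X=\Big\{z\in\mathbb{C}^d:\ \prod_{\rho_i\in\mathcal{P}}z_i=0\ \text{ for every primitive collection } \mathcal{P}\Big\},$$ which is the union of the $n$-dimensional coordinate subspaces $X_\sigma=\{z: z_i=0 \text{ whenever } \rho_i\not\subset\sigma\}$, where $\sigma$ runs over the $n$-dimensional cones of $\Sigma$. Let $\mathscr{O}(X)$ be the space of holomorphic functions on $X$, i.e. functions $X\to\mathbb{C}$ that locally are restrictions of holomorphic functions on open subsets of $\mathbb{C}^d$. Let $\mathcal{A}^{0,q}(X)$ be the space of smooth $(0,q)$-forms on $X$, i.e. of families $(\omega_\sigma)_\sigma$, where $\omega_\sigma$ is a $C^\infty$ form of type $(0,q)$ on $X_\sigma$ and $\omega_\sigma|_{X_\sigma\cap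 X_\tau}=\omega_\tau|_{X_\sigma\cap X_\tau}$ (pull-back of forms) whenever $\dim(X_\sigma\cap X_\tau)=n-1$. Let $\bar\partial:\mathcal{A}^{0,q}(X)\to\mathcal{A}^{0,q+1}(X)$ act componentwise, and let $\mathscr{O}(X)\to\mathcal{A}^{0,0}(X)$ be given by restriction to the components. Theorem (Dolbeault resolution of $\mathscr{O}(X)$). The complex $$0\to\mathcal{A}^{0,0}(X)\xrightarrow{\bar\partial}\mathcal{A}^{0,1}(X)\xrightarrow{\bar\partial}\mathcal{A}^{0,2}(X)\xrightarrow{\bar\partial}\cdots$$ is a resolution of $\mathscr{O}(X)$; that is, the sequence $$0\to\mathscr{O}(X)\to\mathcal{A}^{0,0}(X)\xrightarrow{\bar\partial}\mathcal{A}^{0,1}(X)\xrightarrow{\bar\partial}\mathcal{A}^{0,2}(X)\xrightarrow{\bar\partial}\cdots$$ is exact. -/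

import Mathlib

open scoped ContDiff Topology

noncomputable section

namespace LogLG

/-! ### Smooth `(0,q)`-forms on a complex vector space and the operator `∂̄` -/

section Forms

variable {V W : Type*} [NormedAddCommGroup V] [NormedSpace ℂ V]
  [NormedAddCommGroup W] [NormedSpace ℂ W]

/-- The complex-antilinear part `v ↦ (L v + i L (i v)) / 2` of a real-linear map `L`
with values in the space of complex-valued real-multilinear alternating `q`-forms on `V`. -/
def antilinearPart {q : ℕ} (L : V →L[ℝ] V [⋀^Fin q]→L[ℝ] ℂ) : V →L[ℝ] V [⋀^Fin q]→L[ℝ] ℂ :=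
  (1 / 2 : ℂ) • (L + Complex.I •
    L.comp ((Complex.I • ContinuousLinearMap.id ℂ V).restrictScalars ℝ))

theorem antilinearPart_apply {q : ℕ} (L : V →L[ℝ] V [⋀^Fin q]→L[ℝ] ℂ) (v : V) (m : Fin q → V) :
    antilinearPart L v m = (1 / 2 : ℂ) * (L v m + Complex.I * L (Complex.I • v) m) := by
  simp [antilinearPart, mul_add]

/-- A complex-valued alternating `q`-form on `V` has type `(0,q)` if it is complex-antilinear in
each of its arguments. -/
def IsAntilinear {q : ℕ} (η : V [⋀^Fin q]→L[ℝ] ℂ) : Prop :=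
  ∀ (m : Fin q → V) (i : Fin q) (c : ℂ) (v : V),
    η (Function.update m i (c • v)) = (starRingEnd ℂ) c * η (Function.update m i v)

variable (V) in
/-- The space `𝒜^{0,q}(V)` of smooth (in the real sense) differential forms of type `(0,q)` on the
complex vector space `V`. -/
def Form (q : ℕ) : Submodule ℂ (V → V [⋀^Fin q]→L[ℝ] ℂ) where
  carrier := {η | ContDiff ℝ ∞ η ∧ ∀ x, IsAntilinear (η x)}
  add_mem' := by
    rintro a b ⟨ha, ha'⟩ ⟨hb, hb'⟩
    refine ⟨ha.add hb, fun x m i c v => ?_⟩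
    simp [ha' x m i c v, hb' x m i c v, mul_add]
  zero_mem' := ⟨contDiff_const, fun x m i c v => by simp⟩
  smul_mem' := by
    rintro c a ⟨ha, ha'⟩
    refine ⟨ha.const_smul c, fun x m i d v => ?_⟩
    simp [ha' x m i d v, mul_left_comm]

/-- The operator `∂̄` on differential forms of type `(0,q)`: in the formula
`dη(x; v₀, …, v_q) = ∑ (-1)^i (D_{v_i} η)(x; v₀, …, v̂_i, …, v_q)` the directional derivative `D_v`
is replaced by its antilinear part `(D_v + i D_{iv}) / 2`; in coordinates,
`∂̄ (f dz̄_J) = ∑_j (∂f/∂z̄_j) dz̄_j ∧ dz̄_J`. -/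
def dbarFun {q : ℕ} (η : V → V [⋀^Fin q]→L[ℝ] ℂ) (x : V) : V [⋀^Fin (q + 1)]→L[ℝ] ℂ :=
  ContinuousAlternatingMap.alternatizeUncurryFin (antilinearPart (fderiv ℝ η x))

theorem dbarFun_apply {q : ℕ} (η : V → V [⋀^Fin q]→L[ℝ] ℂ) (x : V) (m : Fin (q + 1) → V) :
    dbarFun η x m = ∑ i : Fin (q + 1), (-1 : ℂ) ^ (i : ℕ) * ((1 / 2 : ℂ) *
      (fderiv ℝ η x (m i) (i.removeNth m)
        + Complex.I * fderiv ℝ η x (Complex.I • m i) (i.removeNth m))) := by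
  simp only [dbarFun, ContinuousAlternatingMap.alternatizeUncurryFin_apply, antilinearPart_apply]
  refine Finset.sum_congr rfl fun i _ => ?_
  simp

theorem fderiv_isAntilinear {q : ℕ} {η : V → V [⋀^Fin q]→L[ℝ] ℂ} (hη : η ∈ Form V q) (x u : V) :
    IsAntilinear (fderiv ℝ η x u) := by
  intro m i c v
  have hd : DifferentiableAt ℝ η x := (hη.1.differentiable (by simp)) x
  have key : ∀ m' : Fin q → V, fderiv ℝ η x u m' = fderiv ℝ (fun y => η y m') x u := by
    intro m'
    have := ((ContinuousAlternatingMap.apply ℝ V ℂ m').hasFDerivAt.comp x hd.hasFDerivAt).fderiv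
    have h2 : (⇑(ContinuousAlternatingMap.apply ℝ V ℂ m') ∘ η) = fun y => η y m' := rfl
    rw [h2] at this
    rw [this]
    rfl
  have hd' : DifferentiableAt ℝ (fun y => η y (Function.update m i v)) x :=
    ((ContinuousAlternatingMap.apply ℝ V ℂ (Function.update m i v)).hasFDerivAt.comp x
      hd.hasFDerivAt).differentiableAt
  rw [key, key]
  have h3 : (fun y => η y (Function.update m i (c • v)))
      = fun y => (starRingEnd ℂ) c * η y (Function.update m i v) := by
    funext y
    exact hη.2 y m i c v
  rw [h3, fderiv_const_mul hd']
  simp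

theorem dbarFun_mem {q : ℕ} {η : V → V [⋀^Fin q]→L[ℝ] ℂ} (hη : η ∈ Form V q) :
    dbarFun η ∈ Form V (q + 1) := by
  have hf : ContDiff ℝ ∞ (fderiv ℝ η) := hη.1.fderiv_right (by simp)
  refine ⟨?_, fun x m k c v => ?_⟩
  · have h1 : ContDiff ℝ ∞ (fun x => antilinearPart (fderiv ℝ η x)) :=
      ((hf.add ((hf.clm_comp contDiff_const).const_smul Complex.I)).const_smul (1 / 2 : ℂ))
    exact (ContinuousAlternatingMap.alternatizeUncurryFinCLM ℝ V ℂ).contDiff.comp h1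
  · rw [dbarFun_apply, dbarFun_apply, Finset.mul_sum]
    refine Finset.sum_congr rfl fun i _ => ?_
    rcases eq_or_ne i k with rfl | hik
    · simp only [Function.update_self, Fin.removeNth_update]
      have hc : c • v = c.re • v + c.im • (Complex.I • v) := by
        conv_lhs => rw [← Complex.re_add_im c]
        rw [add_smul, mul_smul]
        rfl
      have hc' : Complex.I • c • v = c.re • (Complex.I • v) - c.im • v := by
        rw [hc, smul_add, smul_comm Complex.I c.re, smul_comm Complex.I c.im, smul_smul Complex.I,
          Complex.I_mul_I, neg_one_smul, smul_neg, sub_eq_add_neg]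
      have hcc : (starRingEnd ℂ) c = (c.re : ℂ) - c.im * Complex.I := by
        apply Complex.ext <;> simp
      rw [hc', hc, hcc]
      simp only [map_add, map_sub, map_smul, ContinuousAlternatingMap.add_apply,
        ContinuousAlternatingMap.sub_apply, ContinuousAlternatingMap.smul_apply,
        Complex.real_smul]
      linear_combination (-1 : ℂ) ^ (i : ℕ) * (1 / 2) * c.im *
        ((fderiv ℝ η x) (Complex.I • v)) (i.removeNth m) * Complex.I_mul_I
    · obtain ⟨j, rfl⟩ := Fin.exists_succAbove_eq hik.symm
      simp only [Fin.removeNth_update_succAbove, ne_eq, hik, not_false_eq_true,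
        Function.update_of_ne]
      rw [fderiv_isAntilinear hη x _ _ j c v, fderiv_isAntilinear hη x _ _ j c v]
      ring

variable (V) in
/-- The operator `∂̄ : 𝒜^{0,q}(V) → 𝒜^{0,q+1}(V)`. -/
def dbar (q : ℕ) : Form V q →ₗ[ℂ] Form V (q + 1) where
  toFun η := ⟨dbarFun η.1, dbarFun_mem η.2⟩
  map_add' η θ := by
    refine Subtype.ext (funext fun x => ContinuousAlternatingMap.ext fun m => ?_)
    have h1 : DifferentiableAt ℝ η.1 x := (η.2.1.differentiable (by simp)) x
    have h2 : DifferentiableAt ℝ θ.1 x := (θ.2.1.differentiable (by simp)) x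
    simp only [Submodule.coe_add, Pi.add_apply, ContinuousAlternatingMap.add_apply, dbarFun_apply,
      fderiv_add h1 h2, add_apply, ← Finset.sum_add_distrib]
    exact Finset.sum_congr rfl fun i _ => by ring
  map_smul' c η := by
    refine Subtype.ext (funext fun x => ContinuousAlternatingMap.ext fun m => ?_)
    have h1 : DifferentiableAt ℝ η.1 x := (η.2.1.differentiable (by simp)) x
    simp only [Submodule.coe_smul, Pi.smul_apply, ContinuousAlternatingMap.smul_apply,
      dbarFun_apply, fderiv_const_smul h1, smul_apply, RingHom.id_apply,
      smul_eq_mul, Finset.mul_sum]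
    exact Finset.sum_congr rfl fun i _ => by ring

/-- The pull-back of `(0,q)`-forms along a complex-linear map. -/
def pullback (q : ℕ) (L : W →L[ℂ] V) : Form V q →ₗ[ℂ] Form W q where
  toFun η := ⟨fun x => (η.1 (L x)).compContinuousLinearMap (L.restrictScalars ℝ), by
    refine ⟨?_, fun x m i c v => ?_⟩
    · exact (ContinuousAlternatingMap.compContinuousLinearMapCLM (L.restrictScalars ℝ)).contDiff.comp
        (η.2.1.comp (L.restrictScalars ℝ).contDiff)
    · have h : ∀ w, (⇑(L.restrictScalars ℝ) ∘ Function.update m i w)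
          = Function.update (⇑L ∘ m) i (L w) := fun w => by
        simpa using Function.comp_update L m i w
      simp only [ContinuousAlternatingMap.compContinuousLinearMap_apply, h, map_smul]
      exact η.2.2 (L x) _ i c (L v)⟩
  map_add' η θ := rfl
  map_smul' c η := rfl

theorem dbar_pullback (q : ℕ) (L : W →L[ℂ] V) (η : Form V q) :
    dbar W q (pullback q L η) = pullback (q + 1) L (dbar V q η) := by
  refine Subtype.ext (funext fun x => ContinuousAlternatingMap.ext fun m => ?_)
  have h1 : DifferentiableAt ℝ η.1 (L x) := (η.2.1.differentiable (by simp)) (L x)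
  have h2 : HasFDerivAt (pullback q L η).1
      ((ContinuousAlternatingMap.compContinuousLinearMapCLM (L.restrictScalars ℝ)).comp
        ((fderiv ℝ η.1 (L x)).comp (L.restrictScalars ℝ))) x :=
    HasFDerivAt.comp (f := fun y => η.1 (L y))
      (g := ⇑(ContinuousAlternatingMap.compContinuousLinearMapCLM (L.restrictScalars ℝ))) x
      (ContinuousLinearMap.hasFDerivAt _) (h1.hasFDerivAt.comp x (L.restrictScalars ℝ).hasFDerivAt)
  change dbarFun (pullback q L η).1 x m = dbarFun η.1 (L x) (⇑L ∘ m)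
  rw [dbarFun_apply, dbarFun_apply, h2.fderiv]
  refine Finset.sum_congr rfl fun i _ => ?_
  have h3 : ∀ v, ((ContinuousAlternatingMap.compContinuousLinearMapCLM (L.restrictScalars ℝ)).comp
        ((fderiv ℝ η.1 (L x)).comp (L.restrictScalars ℝ))) v (i.removeNth m)
      = fderiv ℝ η.1 (L x) (L v) (i.removeNth (⇑L ∘ m)) := fun v => rfl
  rw [h3, h3, map_smul]
  rfl

end Forms

/-! ### Fans -/

/-- The inclusion of the lattice `N = ℤⁿ` into `N_ℝ = ℝⁿ`. -/
def latticeVec {n : ℕ} (u : Fin n → ℤ) : Fin n → ℝ := fun i => (u i : ℝ)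

/-- The dimension of a cone: the dimension of its linear span. -/
def coneDim {n : ℕ} (σ : PointedCone ℝ (Fin n → ℝ)) : ℕ :=
  Module.finrank ℝ (Submodule.span ℝ (σ : Set (Fin n → ℝ)))

/-- A fan in `N_ℝ = ℝⁿ` with respect to the lattice `N = ℤⁿ`: a finite set of strongly convex
rational polyhedral cones, closed under taking faces, in which any two cones meet in a common
face. -/
structure Fan (n : ℕ) where
  cones : Set (PointedCone ℝ (Fin n → ℝ))
  finite_cones : cones.Finite
  rational : ∀ σ ∈ cones, ∃ s : Finset (Fin n → ℤ),
    σ = PointedCone.hull ℝ (latticeVec '' (s : Set _))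
  strongly_convex : ∀ σ ∈ cones, ∀ v ∈ σ, -v ∈ σ → v = 0
  face_mem : ∀ σ ∈ cones, ∀ τ : PointedCone ℝ (Fin n → ℝ), τ.IsFaceOf σ → τ ∈ cones
  inf_isFaceOf : ∀ σ ∈ cones, ∀ τ ∈ cones, (σ ⊓ τ).IsFaceOf σ ∧ (σ ⊓ τ).IsFaceOf τ

namespace Fan

variable {n : ℕ} (F : Fan n)

/-- A fan is complete if its cones cover `N_ℝ`. -/
def IsComplete : Prop := ∀ v : Fin n → ℝ, ∃ σ ∈ F.cones, v ∈ σ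

/-- A fan is smooth if each of its cones is generated by a part of a `ℤ`-basis of the lattice. -/
def IsSmooth : Prop :=
  ∀ σ ∈ F.cones, ∃ (b : Module.Basis (Fin n) ℤ (Fin n → ℤ)) (s : Set (Fin n)),
    σ = PointedCone.hull ℝ ((fun i => latticeVec (b i)) '' s)

/-- The existence of a strictly convex piecewise linear function `ψ` with integral slopes, i.e.
the projectivity of the toric variety of a complete fan: on each `n`-dimensional cone `σ`, `ψ` is
given by an integral linear form `m`, and `ψ > m` outside `σ`. -/
def IsProjective : Prop :=
  ∃ ψ : (Fin n → ℝ) → ℝ, ∀ σ ∈ F.cones, coneDim σ = n →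
    ∃ m : Fin n → ℤ, (∀ v ∈ σ, ψ v = ∑ i, (m i : ℝ) * v i) ∧
      ∀ v ∉ σ, ∑ i, (m i : ℝ) * v i < ψ v

/-- The set `Σ(1)` of rays (one-dimensional cones) of the fan. Each ray has exactly one primitive
generator, so that `Σ(1)` is also the set of primitive generators `ρ₁, …, ρ_d`. -/
def Ray : Type := {ρ : PointedCone ℝ (Fin n → ℝ) // ρ ∈ F.cones ∧ coneDim ρ = 1}

instance : Finite F.Ray :=
  (F.finite_cones.subset fun _ h => h.1 :
    {ρ : PointedCone ℝ (Fin n → ℝ) | ρ ∈ F.cones ∧ coneDim ρ = 1}.Finite).to_subtype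

instance : Fintype F.Ray := Fintype.ofFinite _

/-- The set of `n`-dimensional cones of the fan. -/
def MaxCone : Type := {σ : PointedCone ℝ (Fin n → ℝ) // σ ∈ F.cones ∧ coneDim σ = n}

/-- A set of rays is a primitive collection if it is not contained in a cone of the fan, but each
proper subset is. (In a smooth fan, a set of rays is contained in a cone if and only if it is the
set of rays of a cone.) -/
def IsPrimitiveCollection (P : Finset F.Ray) : Prop :=
  (¬ ∃ σ ∈ F.cones, ∀ ρ ∈ P, ρ.1 ≤ σ) ∧ ∀ Q, Q ⊂ P → ∃ σ ∈ F.cones, ∀ ρ ∈ Q, ρ.1 ≤ σ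

/-! ### The singular fibre `X`, its components, and functions and forms on it -/

/-- The singular fibre `X ⊆ ℂ^d`, cut out by the equations `∏_{ρ ∈ P} z_ρ = 0` for all primitive
collections `P`. These monomials generate the (radical) Stanley–Reisner ideal. -/
def fiber : Set (F.Ray → ℂ) :=
  {z | ∀ P : Finset F.Ray, F.IsPrimitiveCollection P → ∏ ρ ∈ P, z ρ = 0}

/-- The component `X_σ` of `X` that corresponds to the `n`-dimensional cone `σ`: the coordinate
subspace of `ℂ^d` on which `z_ρ = 0` for each ray `ρ` that is not contained in `σ`. -/
def component (σ : F.MaxCone) : Submodule ℂ (F.Ray → ℂ) where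
  carrier := {z | ∀ ρ : F.Ray, ¬ ρ.1 ≤ σ.1 → z ρ = 0}
  add_mem' := by
    intro a b ha hb ρ hρ
    simp [ha ρ hρ, hb ρ hρ]
  zero_mem' := fun _ _ => rfl
  smul_mem' := by
    intro c a ha ρ hρ
    simp [ha ρ hρ]

theorem component_subset_fiber (σ : F.MaxCone) {z : F.Ray → ℂ} (hz : z ∈ F.component σ) :
    z ∈ F.fiber := by
  intro P hP
  by_contra h
  refine hP.1 ⟨σ.1, σ.2.1, fun ρ hρ => ?_⟩
  by_contra hρσ
  exact h (Finset.prod_eq_zero hρ (hz ρ hρσ))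

/-- The space `𝒪(X)` of holomorphic functions on `X`: the functions on `X` that locally are
restrictions of holomorphic functions on open subsets of `ℂ^d`. -/
def holo : Submodule ℂ (F.fiber → ℂ) where
  carrier := {f | ∀ x : F.fiber, ∃ g : (F.Ray → ℂ) → ℂ, AnalyticAt ℂ g x.1 ∧
    ∀ᶠ y in 𝓝 x, f y = g y.1}
  add_mem' := by
    intro a b ha hb x
    obtain ⟨g, hg, hag⟩ := ha x
    obtain ⟨h, hh, hbh⟩ := hb x
    refine ⟨g + h, hg.add hh, ?_⟩
    filter_upwards [hag, hbh] with y h1 h2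
    simp [h1, h2]
  zero_mem' := fun x => ⟨0, analyticAt_const, by simp⟩
  smul_mem' := by
    intro c a ha x
    obtain ⟨g, hg, hag⟩ := ha x
    refine ⟨c • g, hg.const_smul, ?_⟩
    filter_upwards [hag] with y h1
    simp [h1]

/-- The restriction of a `(0,q)`-form from the component `X_σ` to `X_σ ∩ X_τ`. -/
def restrictLeft (q : ℕ) (σ τ : F.MaxCone) :
    Form (F.component σ) q →ₗ[ℂ] Form (F.component σ ⊓ F.component τ : Submodule ℂ _) q :=
  pullback q (LinearMap.toContinuousLinearMap (Submodule.inclusion inf_le_left))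

/-- The restriction of a `(0,q)`-form from the component `X_τ` to `X_σ ∩ X_τ`. -/
def restrictRight (q : ℕ) (σ τ : F.MaxCone) :
    Form (F.component τ) q →ₗ[ℂ] Form (F.component σ ⊓ F.component τ : Submodule ℂ _) q :=
  pullback q (LinearMap.toContinuousLinearMap (Submodule.inclusion inf_le_right))

/-- The space `𝒜^{0,q}(X)` of smooth `(0,q)`-forms on `X`: families of smooth `(0,q)`-forms on the
`n`-dimensional components of `X`, two of which agree on the intersection of their components
whenever this intersection has dimension `n - 1`. -/
def forms (q : ℕ) : Submodule ℂ (∀ σ : F.MaxCone, Form (F.component σ) q) where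
  carrier := {η | ∀ σ τ : F.MaxCone,
    Module.finrank ℂ (F.component σ ⊓ F.component τ : Submodule ℂ (F.Ray → ℂ)) + 1 = n →
      F.restrictLeft q σ τ (η σ) = F.restrictRight q σ τ (η τ)}
  add_mem' := by
    intro a b ha hb σ τ h
    simp only [Pi.add_apply, map_add, ha σ τ h, hb σ τ h]
  zero_mem' := by
    intro σ τ _
    simp only [Pi.zero_apply, map_zero]
  smul_mem' := by
    intro c a ha σ τ h
    simp only [Pi.smul_apply, map_smul, ha σ τ h]

/-- The operator `∂̄ : 𝒜^{0,q}(X) → 𝒜^{0,q+1}(X)`, acting on each component of `X`. -/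
def dbarX (q : ℕ) : F.forms q →ₗ[ℂ] F.forms (q + 1) where
  toFun η := ⟨fun σ => dbar (F.component σ) q (η.1 σ), by
    intro σ τ h
    have := congrArg (dbar _ q) (η.2 σ τ h)
    simpa only [restrictLeft, restrictRight, dbar_pullback] using this⟩
  map_add' η θ := by
    refine Subtype.ext (funext fun σ => ?_)
    exact map_add (dbar (F.component σ) q) _ _
  map_smul' c η := by
    refine Subtype.ext (funext fun σ => ?_)
    exact map_smul (dbar (F.component σ) q) _ _

theorem holo_restrict_mem {f : F.fiber → ℂ} (hf : f ∈ F.holo) (σ : F.MaxCone) :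
    (fun x : F.component σ => ContinuousAlternatingMap.constOfIsEmpty ℝ (F.component σ) (Fin 0)
      (f ⟨x.1, F.component_subset_fiber σ x.2⟩)) ∈ Form (F.component σ) 0 := by
  refine ⟨?_, fun x m i => i.elim0⟩
  have h : ContDiff ℝ ∞ (fun x : F.component σ => f ⟨x.1, F.component_subset_fiber σ x.2⟩) := by
    rw [contDiff_iff_contDiffAt]
    intro x
    obtain ⟨g, hg, hfg⟩ := hf ⟨x.1, F.component_subset_fiber σ x.2⟩
    have h1 : AnalyticAt ℂ (fun y : F.component σ => g y.1) x :=
      hg.comp_of_eq ((F.component σ).subtypeL.analyticAt x) rfl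
    have h2 : ContDiffAt ℝ ∞ (fun y : F.component σ => g y.1) x :=
      h1.contDiffAt.restrict_scalars ℝ
    refine h2.congr_of_eventuallyEq ?_
    have hc : Continuous (fun y : F.component σ =>
        (⟨y.1, F.component_subset_fiber σ y.2⟩ : F.fiber)) := by fun_prop
    exact hc.continuousAt.eventually hfg
  exact (ContinuousAlternatingMap.constOfIsEmptyLIE ℝ (F.component σ) ℂ (Fin 0)).contDiff.comp h

/-- The map `𝒪(X) → 𝒜^{0,0}(X)`: a holomorphic function on `X` is regarded as the family of its
restrictions to the components of `X`. -/
def ofHolo : F.holo →ₗ[ℂ] F.forms 0 where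
  toFun f := ⟨fun σ => ⟨_, F.holo_restrict_mem f.2 σ⟩, fun σ τ _ => by
    refine Subtype.ext (funext fun x => ContinuousAlternatingMap.ext fun m => ?_)
    rfl⟩
  map_add' f g := by
    refine Subtype.ext (funext fun σ => Subtype.ext (funext fun x =>
      ContinuousAlternatingMap.ext fun m => ?_))
    rfl
  map_smul' c f := by
    refine Subtype.ext (funext fun σ => Subtype.ext (funext fun x =>
      ContinuousAlternatingMap.ext fun m => ?_))
    rfl

end Fan

end LogLG

end

/-! Everything is reduced to the smooth space ℂ^d by extension of forms: each family in `F.forms q`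
is the restriction of one form Ω on ℂ^d, and a closed family has a closed extension
(`exists_extension`). Exactness then follows from two facts on ℂ^d: a closed form of positive degree
is ∂̄-exact (`exists_dbarFun_eq`), and a smooth function killed by ∂̄ is analytic
(`analyticAt_of_dbarFun_eq_zero`). Primitives and holomorphic functions are restricted back to X.

The extension treats one component at a time. Let p_σ be the coordinate projection onto X_σ;
replacing Ω by Ω + p_σ^*(η_σ - Ω|X_σ) makes it right on X_σ. Since p_σ maps X_τ into X_σ ∩ X_τ, a
component X_τ treated before keeps its value, provided η_σ and η_τ agree on the whole of X_σ ∩ X_τ.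
The definition demands this only in codimension one. The general case
(`restrictLeft_eq_restrictRight`) needs a chain of maximal cones from σ to τ, all containing σ ∩ τ
and each sharing a facet with the next. Projectivity provides it (`IsProjective.induction_maxCone`):
for y in the interior of τ, crossing a facet of κ towards y strictly increases the value at y of the
linear piece of ψ on κ, so the walk can only end at τ.

The Poincaré lemma on ℂ^d removes one dz̄_i at a time by the formula ∂̄ι_e + ι_e∂̄ = D̄_e for the
contraction ι_e and the antiholomorphic derivative D̄_e. It rests on solving D̄_e u = f on the whole
space for an arbitrary smooth f (`exists_isDbarSolution`). There f is cut into pieces over annuli in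
the coordinate ℓ. Each piece is solved by a Cauchy transform, twisted by powers of ℓ so that the
solution is tiny on the part of a large ball lying over a smaller disc, and the solutions are
summed. -/

open scoped ContDiff Topology

noncomputable section

namespace LogLG

universe u

/-! ### Calculus of ∂̄: contractions, Cartan's formula, ∂̄² = 0 -/

section DbarCalculus

variable {V : Type*} [NormedAddCommGroup V] [NormedSpace ℂ V]
  {F : Type*} [NormedAddCommGroup F] [NormedSpace ℝ F] [NormedSpace ℂ F]

/-- The antiholomorphic directional derivative `(D_e + i D_{ie}) / 2`. -/
def dbarDir (e : V) (f : V → F) (x : V) : F :=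
  (1 / 2 : ℂ) • (fderiv ℝ f x e + Complex.I • fderiv ℝ f x (Complex.I • e))

/-- The contraction of a differential form with a constant vector field. -/
def contract {q : ℕ} (e : V) (η : V → V [⋀^Fin (q + 1)]→L[ℝ] ℂ) (x : V) : V [⋀^Fin q]→L[ℝ] ℂ :=
  (η x).curryLeft e

/-- Contraction with a constant vector, as a real-linear map on alternating forms. -/
def contractCLM (q : ℕ) (e : V) : (V [⋀^Fin (q + 1)]→L[ℝ] ℂ) →L[ℝ] V [⋀^Fin q]→L[ℝ] ℂ :=
  (ContinuousLinearMap.apply ℝ _ e).comp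
    (ContinuousAlternatingMap.curryLeftLI (𝕜 := ℝ) (E := V) (F := ℂ) (n := q)).toContinuousLinearMap

theorem fderiv_contract {q : ℕ} {η : V → V [⋀^Fin (q + 1)]→L[ℝ] ℂ} (e : V) {x : V}
    (h : DifferentiableAt ℝ η x) (v : V) :
    fderiv ℝ (contract e η) x v = (fderiv ℝ η x v).curryLeft e := by
  have := ((contractCLM q e).hasFDerivAt.comp x h.hasFDerivAt).fderiv
  change fderiv ℝ (contractCLM q e ∘ η) x v = _
  rw [this]
  rfl

theorem contract_mem {q : ℕ} {η : V → V [⋀^Fin (q + 1)]→L[ℝ] ℂ} (e : V) (hη : η ∈ Form V (q + 1)) :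
    contract e η ∈ Form V q := by
  refine ⟨(contractCLM q e).contDiff.comp hη.1, fun x m i c v => ?_⟩
  have h : ∀ w, Matrix.vecCons e (Function.update m i w)
      = Function.update (Matrix.vecCons e m) i.succ w := fun w => by
    simp [Matrix.vecCons, Fin.cons_update]
  simp only [contract, ContinuousAlternatingMap.curryLeft_apply_apply, h]
  exact hη.2 x _ _ c v

/-- Cartan's formula for `∂̄` and the contraction with a constant vector field. -/
theorem dbarFun_contract_add {q : ℕ} {η : V → V [⋀^Fin (q + 1)]→L[ℝ] ℂ} (e : V) {x : V}
    (h : DifferentiableAt ℝ η x) :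
    dbarFun (contract e η) x + contract e (dbarFun η) x = dbarDir e η x := by
  ext m
  have h0 : contract e (dbarFun η) x m = dbarFun η x (Matrix.vecCons e m) := rfl
  rw [ContinuousAlternatingMap.add_apply, h0, dbarFun_apply, dbarFun_apply]
  rw [Fin.sum_univ_succ (n := q + 1)]
  have h1 : ∀ i : Fin (q + 1), i.succ.removeNth (Matrix.vecCons e m)
      = Matrix.vecCons e (i.removeNth m) := fun i => by
    funext j
    refine Fin.cases ?_ (fun j => ?_) j
    · simp [Fin.removeNth]
    · simp [Fin.removeNth]
  have h2 : (0 : Fin (q + 2)).removeNth (Matrix.vecCons e m) = m := by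
    funext j
    simp [Fin.removeNth]
  simp only [fderiv_contract e h, h1, h2, ContinuousAlternatingMap.curryLeft_apply_apply, Matrix.cons_val_zero,
    Matrix.cons_val_succ, Fin.val_zero, pow_zero, Fin.val_succ, pow_succ, dbarDir,
    ContinuousAlternatingMap.smul_apply, ContinuousAlternatingMap.add_apply, smul_eq_mul]
  rw [add_left_comm, ← Finset.sum_add_distrib, Finset.sum_eq_zero, add_zero, one_mul]
  intro i _
  ring

variable (V) (W : Type*) [NormedAddCommGroup W] [NormedSpace ℝ W] [NormedSpace ℂ W]
  [IsScalarTower ℝ ℂ W] in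
/-- The complex-antilinear part of a real-linear map, depending linearly on the map. -/
def antilinearPartCLM : (V →L[ℝ] W) →L[ℝ] (V →L[ℝ] W) :=
  ((1 / 2 : ℂ) • ContinuousLinearMap.id ℝ (V →L[ℝ] W)).comp
    (ContinuousLinearMap.id ℝ (V →L[ℝ] W) +
      (Complex.I • ContinuousLinearMap.id ℝ (V →L[ℝ] W)).comp
        ((ContinuousLinearMap.compL ℝ V V W).flip
          ((Complex.I • ContinuousLinearMap.id ℂ V).restrictScalars ℝ)))

/-- Taking antilinear parts in both arguments of the symmetric second derivative leaves it
symmetric, and alternating a symmetric bilinear expression twice gives zero. -/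
theorem dbarFun_dbarFun {q : ℕ} {η : V → V [⋀^Fin q]→L[ℝ] ℂ} (hη : ContDiff ℝ ∞ η) :
    dbarFun (dbarFun η) = 0 := by
  funext x
  have hd : ContDiff ℝ ∞ (fderiv ℝ η) := hη.fderiv_right (by simp)
  have hd' : DifferentiableAt ℝ (fderiv ℝ η) x := (hd.differentiable (by simp)) x
  have hsymm : ∀ u v, fderiv ℝ (fderiv ℝ η) x u v = fderiv ℝ (fderiv ℝ η) x v u := fun u v =>
    (hη.contDiffAt (x := x)).isSymmSndFDerivAt
      (by simpa using (WithTop.coe_le_coe.2 le_top : ((2 : ℕ∞) : WithTop ℕ∞) ≤ ∞)) u v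
  let A := antilinearPartCLM V (V [⋀^Fin q]→L[ℝ] ℂ)
  have hA : ∀ L, A L = antilinearPart L := fun L => rfl
  let B := fderiv ℝ (fderiv ℝ η) x
  let G : V →L[ℝ] (V →L[ℝ] V [⋀^Fin q]→L[ℝ] ℂ) := A.comp B
  have hder : fderiv ℝ (dbarFun η) x
      = (ContinuousAlternatingMap.alternatizeUncurryFinCLM ℝ V ℂ).comp G := by
    have h1 : HasFDerivAt (fun y => A (fderiv ℝ η y)) G x :=
      A.hasFDerivAt.comp x hd'.hasFDerivAt
    exact (((ContinuousAlternatingMap.alternatizeUncurryFinCLM ℝ V ℂ).hasFDerivAt).comp x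
      h1).fderiv
  let H : V →L[ℝ] (V →L[ℝ] V [⋀^Fin q]→L[ℝ] ℂ) := antilinearPartCLM V (V →L[ℝ] V [⋀^Fin q]→L[ℝ] ℂ) G
  have hHv : ∀ v w m, H v w m = (1 / 2 : ℂ) * (G v w m + Complex.I * G (Complex.I • v) w m) :=
    fun v w m => rfl
  have hGv : ∀ v w m, G v w m = (1 / 2 : ℂ) * (B v w m + Complex.I * B v (Complex.I • w) m) :=
    fun v w m => rfl
  have hH : antilinearPart ((ContinuousAlternatingMap.alternatizeUncurryFinCLM ℝ V ℂ).comp G)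
      = (ContinuousAlternatingMap.alternatizeUncurryFinCLM ℝ V ℂ).comp H := by
    ext v m
    simp only [antilinearPart_apply, ContinuousLinearMap.comp_apply,
      ContinuousAlternatingMap.alternatizeUncurryFinCLM_apply,
      ContinuousAlternatingMap.alternatizeUncurryFin_apply, hHv,
      Finset.mul_sum, ← Finset.sum_add_distrib]
    refine Finset.sum_congr rfl fun i _ => ?_
    simp only [zsmul_eq_mul]
    ring
  change ContinuousAlternatingMap.alternatizeUncurryFin (antilinearPart (fderiv ℝ (dbarFun η) x))
    = 0
  rw [hder, hH]
  refine ContinuousAlternatingMap.alternatizeUncurryFin_alternatizeUncurryFinCLM_comp_of_symmetric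
    fun u v => ?_
  ext m
  simp only [hHv, hGv, B]
  rw [hsymm u v, hsymm u (Complex.I • v), hsymm (Complex.I • u) v,
    hsymm (Complex.I • u) (Complex.I • v)]
  ring

theorem dbarFun_sub {q : ℕ} {η θ : V → V [⋀^Fin q]→L[ℝ] ℂ} (hη : ContDiff ℝ ∞ η)
    (hθ : ContDiff ℝ ∞ θ) : dbarFun (η - θ) = dbarFun η - dbarFun θ := by
  funext x
  ext m
  have h1 : DifferentiableAt ℝ η x := (hη.differentiable (by simp)) x
  have h2 : DifferentiableAt ℝ θ x := (hθ.differentiable (by simp)) x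
  simp only [Pi.sub_apply, ContinuousAlternatingMap.sub_apply, dbarFun_apply,
    fderiv_sub h1 h2, sub_apply, ← Finset.sum_sub_distrib]
  exact Finset.sum_congr rfl fun i _ => by ring

theorem dbarFun_add {q : ℕ} {η θ : V → V [⋀^Fin q]→L[ℝ] ℂ} (hη : ContDiff ℝ ∞ η)
    (hθ : ContDiff ℝ ∞ θ) : dbarFun (η + θ) = dbarFun η + dbarFun θ := by
  have h : ContDiff ℝ ∞ (η + θ) := hη.add hθ
  rw [← sub_eq_iff_eq_add', ← dbarFun_sub h hη, add_sub_cancel_left]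

theorem dbarFun_zero {q : ℕ} : dbarFun (0 : V → V [⋀^Fin q]→L[ℝ] ℂ) = 0 :=
  congrArg Subtype.val (map_zero (dbar V q))

theorem contract_zero {q : ℕ} (e : V) : contract e (0 : V → V [⋀^Fin (q + 1)]→L[ℝ] ℂ) = 0 :=
  funext fun _ => map_zero (contractCLM q e)

theorem dbarFun_contract {q : ℕ} {η : V → V [⋀^Fin (q + 1)]→L[ℝ] ℂ} (e : V)
    (h : Differentiable ℝ η) :
    dbarFun (contract e η) = dbarDir e η - contract e (dbarFun η) :=
  funext fun x => eq_sub_of_add_eq (dbarFun_contract_add e (h x))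

theorem contract_dbarFun {q : ℕ} {η : V → V [⋀^Fin (q + 1)]→L[ℝ] ℂ} (e : V)
    (h : Differentiable ℝ η) :
    contract e (dbarFun η) = dbarDir e η - dbarFun (contract e η) :=
  funext fun x => eq_sub_of_add_eq' (dbarFun_contract_add e (h x))

/-- By Cartan's formula, a closed form without a dz̄ component along `e` has coefficients
holomorphic in the direction `e`. -/
theorem dbarDir_eq_zero_of_contract {q : ℕ} {η : V → V [⋀^Fin (q + 1)]→L[ℝ] ℂ} {e : V}
    (h : Differentiable ℝ η) (hc : contract e η = 0) (hd : dbarFun η = 0) : dbarDir e η = 0 := by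
  have := dbarFun_contract e h
  rw [hc, hd, dbarFun_zero, contract_zero, sub_zero] at this
  exact this.symm

theorem contract_self {q : ℕ} (e : V) (η : V → V [⋀^Fin (q + 2)]→L[ℝ] ℂ) :
    contract e (contract e η) = 0 := by
  funext x
  ext m
  simp only [contract, ContinuousAlternatingMap.curryLeft_apply_apply]
  refine (η x).map_eq_zero_of_eq _ (i := 0) (j := 1) ?_ (by simp)
  simp

/-- Polarization of `contract_self` at `e + e'`. -/
theorem contract_comm {q : ℕ} (e e' : V) (η : V → V [⋀^Fin (q + 2)]→L[ℝ] ℂ) :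
    contract e (contract e' η) = - contract e' (contract e η) := by
  have h := contract_self (e + e') η
  funext x
  ext m
  have hz : (0 : V [⋀^Fin q]→L[ℝ] ℂ) m = 0 := rfl
  have hx := DFunLike.congr_fun (congrFun h x) m
  have h1 := DFunLike.congr_fun (congrFun (contract_self e η) x) m
  have h2 := DFunLike.congr_fun (congrFun (contract_self e' η) x) m
  simp only [contract, map_add, add_apply, ContinuousAlternatingMap.add_apply, Pi.zero_apply,
    ContinuousAlternatingMap.curryLeft_add, hz] at hx h1 h2
  simp only [contract, Pi.neg_apply, ContinuousAlternatingMap.neg_apply]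
  rw [h1, h2] at hx
  linear_combination hx

end DbarCalculus

/-! ### The Cauchy transform along a complex line -/

section CauchyTransform

open MeasureTheory Set

/-- **Cauchy–Pompeiu formula** at the origin for compactly supported functions. -/
theorem integral_inv_smul_dbar {F : Type*} [NormedAddCommGroup F] [NormedSpace ℝ F]
    [NormedSpace ℂ F] [IsScalarTower ℝ ℂ F] [CompleteSpace F] {h : ℂ → F} (hh : ContDiff ℝ 1 h)
    {R : ℝ} (hR : 0 < R) (hsupp : ∀ z, R ≤ ‖z‖ → h z = 0) :
    ∫ z : ℂ, z⁻¹ • (fderiv ℝ h z 1 + Complex.I • fderiv ℝ h z Complex.I)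
      = -((2 * Real.pi : ℝ) • h 0) := by
  have hd : Differentiable ℝ h := hh.differentiable one_ne_zero
  have hc : Continuous (fderiv ℝ h) := hh.continuous_fderiv one_ne_zero
  have hsm : ∀ (r : ℝ) (x : F), (r : ℂ) • x = r • x := fun r x => algebraMap_smul ℂ r x
  let ex : ℝ → ℂ := fun t => Real.cos t + Real.sin t * Complex.I
  have hex : Continuous ex := by fun_prop
  have hdz : ∀ z, R < ‖z‖ → fderiv ℝ h z = 0 := fun z hz => by
    have : h =ᶠ[𝓝 z] fun _ => 0 := by
      filter_upwards [continuous_norm.continuousAt.eventually (lt_mem_nhds hz)] with y hy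
      exact hsupp y hy.le
    rw [this.fderiv_eq]
    simp
  let A : ℝ × ℝ → F := fun p => fderiv ℝ h (p.1 * ex p.2) (ex p.2)
  let B : ℝ × ℝ → F := fun p => fderiv ℝ h (p.1 * ex p.2) (Complex.I * ex p.2)
  have hA : Continuous A := by fun_prop
  have hB : Continuous B := by fun_prop
  have hexn : ∀ t, ‖ex t‖ = 1 := fun t => by
    have : ex t = Complex.exp (t * Complex.I) := by
      simp only [ex]
      rw [Complex.exp_mul_I]
      push_cast
      rfl
    rw [this, Complex.norm_exp_ofReal_mul_I]
  have hint : ∀ G : ℝ × ℝ → F, Continuous G →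
      IntegrableOn G (Ioc 0 R ×ˢ Ioo (-Real.pi) Real.pi) := fun G hG =>
    (hG.continuousOn.integrableOn_compact
      (isCompact_Icc.prod isCompact_Icc)).mono_set
        (prod_mono Ioc_subset_Icc_self Ioo_subset_Icc_self)
  rw [← Complex.integral_comp_polarCoord_symm]
  -- The Jacobian r cancels the modulus of 1/z, and the remaining phase turns D_1 + i D_i into the
  -- radial derivative `A` plus i times the angular derivative `B` (divided by r). Hence the
  -- singularity disappears.
  have h1 : ∀ p ∈ polarCoord.target, p.1 • ((Complex.polarCoord.symm p)⁻¹ •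
      (fderiv ℝ h (Complex.polarCoord.symm p) 1
        + Complex.I • fderiv ℝ h (Complex.polarCoord.symm p) Complex.I))
      = A p + Complex.I • B p := by
    rintro ⟨r, t⟩ hp
    have hr : 0 < r := hp.1
    have hz : Complex.polarCoord.symm (r, t) = r * ex t := by
      rw [Complex.polarCoord_symm_apply]
    rw [hz]
    simp only [A, B]
    set D := fderiv ℝ h (r * ex t)
    have e1 : D (ex t) = (Real.cos t : ℂ) • D 1 + (Real.sin t : ℂ) • D Complex.I := by
      have : ex t = Real.cos t • (1 : ℂ) + Real.sin t • Complex.I := by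
        simp [ex]
      rw [this, map_add, map_smul, map_smul]
      simp only [hsm]
    have e2 : D (Complex.I * ex t) = (Real.cos t : ℂ) • D Complex.I - (Real.sin t : ℂ) • D 1 := by
      have : Complex.I * ex t = Real.cos t • Complex.I - Real.sin t • (1 : ℂ) := by
        simp only [ex, Complex.real_smul]
        linear_combination (Real.sin t : ℂ) * Complex.I_mul_I
      rw [this, map_sub, map_smul, map_smul]
      simp only [hsm]
    have e3 : (r : ℂ) * (r * ex t)⁻¹ = Real.cos t - Real.sin t * Complex.I := by
      have hne : ex t ≠ 0 := fun h0 => by simpa [h0] using hexn t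
      have hrc : (r : ℂ) ≠ 0 := by exact_mod_cast hr.ne'
      have hcs : (Real.cos t : ℂ) ^ 2 + (Real.sin t : ℂ) ^ 2 = 1 := by
        exact_mod_cast Real.cos_sq_add_sin_sq t
      rw [mul_inv, ← mul_assoc, mul_inv_cancel₀ hrc, one_mul, inv_eq_iff_eq_inv]
      refine eq_inv_of_mul_eq_one_left ?_
      simp only [ex]
      linear_combination hcs - (Real.sin t : ℂ) ^ 2 * Complex.I_sq
    rw [e1, e2, ← hsm, smul_smul, e3]
    have hII : Complex.I * Complex.I = -1 := Complex.I_mul_I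
    have hsplit : ∀ (c s : ℂ) (a b : F), (c - s * Complex.I) • (a + Complex.I • b)
        = (c • a + s • b) + Complex.I • (c • b - s • a) := fun c s a b => by
      have e4 : (c - s * Complex.I) * Complex.I = Complex.I * c + s := by
        linear_combination -s * hII
      simp only [smul_add, smul_sub, smul_smul, e4]
      rw [sub_smul, add_smul, mul_comm Complex.I s]
      abel
    exact hsplit _ _ _ _
  rw [setIntegral_congr_fun polarCoord.open_target.measurableSet h1]
  have hsub : Ioc 0 R ×ˢ Ioo (-Real.pi) Real.pi ⊆ polarCoord.target :=
    prod_mono Ioc_subset_Ioi_self subset_rfl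
  rw [setIntegral_eq_of_subset_of_forall_sdiff_eq_zero (s := Ioc 0 R ×ˢ Ioo (-Real.pi) Real.pi)
    polarCoord.open_target.measurableSet hsub]
  rotate_left
  · rintro ⟨r, t⟩ ⟨⟨hr, ht⟩, hnot⟩
    have hr' : R < r := by
      by_contra hcon
      exact hnot ⟨⟨hr, not_lt.1 hcon⟩, ht⟩
    have hn : R < ‖(r : ℂ) * ex t‖ := by
      rw [norm_mul, hexn, mul_one, Complex.norm_real, Real.norm_eq_abs]
      exact hr'.trans_le (le_abs_self r)
    simp only [A, B, hdz _ hn]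
    simp
  rw [integral_add (hint A hA) (hint (fun p => Complex.I • B p) (hB.const_smul Complex.I))]
  have hmulT : ∀ (w : ℂ) (t : ℝ), HasDerivAt (fun r : ℝ => (r : ℂ) * w) w t := fun w t => by
    simpa using (Complex.ofRealCLM.hasDerivAt (x := t)).mul_const w
  have iA : ∫ p in Ioc 0 R ×ˢ Ioo (-Real.pi) Real.pi, A p = -((2 * Real.pi : ℝ) • h 0) := by
    have hi := hint A hA
    rw [Measure.volume_eq_prod, IntegrableOn, ← Measure.prod_restrict] at hi
    rw [Measure.volume_eq_prod, ← Measure.prod_restrict, integral_prod_symm _ hi]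
    -- Along a radius, `A` is the derivative of `h`, which vanishes at distance `R`; only the value
    -- at the centre survives.
    have : ∀ t : ℝ, ∫ r in Ioc 0 R, A (r, t) = -h 0 := fun t => by
      rw [← intervalIntegral.integral_of_le hR.le,
        intervalIntegral.integral_eq_sub_of_hasDerivAt (f := fun r : ℝ => h (r * ex t))]
      · rw [hsupp (R * ex t) (by rw [norm_mul, hexn]; simp [le_abs_self])]
        simp
      · intro r _
        exact ((hd _).hasFDerivAt.comp_hasDerivAt r (hmulT (ex t) r))
      · exact (by fun_prop : Continuous fun r : ℝ => A (r, t)).intervalIntegrable _ _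
    simp only [this, setIntegral_const, Real.volume_real_Ioo_of_le (by linarith [Real.pi_pos] :
      -Real.pi ≤ Real.pi), smul_neg]
    congr 2
    ring
  have iB : ∫ p in Ioc 0 R ×ˢ Ioo (-Real.pi) Real.pi, Complex.I • B p = 0 := by
    rw [integral_smul]
    have hi := hint B hB
    rw [Measure.volume_eq_prod] at hi
    rw [Measure.volume_eq_prod, setIntegral_prod _ hi]
    -- Along a circle, `r • B` is the derivative of a periodic function.
    have : ∀ r ∈ Ioc 0 R, ∫ t in Ioo (-Real.pi) Real.pi, B (r, t) = 0 := fun r hr => by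
      rw [← integral_Ioc_eq_integral_Ioo, ← intervalIntegral.integral_of_le
        (by linarith [Real.pi_pos])]
      have hder : ∀ t : ℝ, HasDerivAt (fun t : ℝ => h (r * ex t)) (r • B (r, t)) t := fun t => by
        have h2 : HasDerivAt (fun t : ℝ => (r : ℂ) * ex t) (r • (Complex.I * ex t)) t := by
          have h3 : HasDerivAt ex (((-Real.sin t : ℝ) : ℂ) + ((Real.cos t : ℝ) : ℂ) * Complex.I)
              t := ((Real.hasDerivAt_cos t).ofReal_comp).add
                (((Real.hasDerivAt_sin t).ofReal_comp).mul_const Complex.I)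
          refine (h3.const_mul (r : ℂ)).congr_deriv ?_
          simp only [ex, Complex.real_smul]
          push_cast
          linear_combination -(r : ℂ) * Complex.sin t * Complex.I_mul_I
        refine ((hd _).hasFDerivAt.comp_hasDerivAt t h2).congr_deriv ?_
        rw [map_smul]
      have h4 : ∫ t in (-Real.pi)..Real.pi, r • B (r, t) = 0 := by
        rw [intervalIntegral.integral_eq_sub_of_hasDerivAt (fun t _ => hder t)]
        · simp [ex]
        · exact (by fun_prop : Continuous fun t : ℝ => r • B (r, t)).intervalIntegrable _ _
      rw [intervalIntegral.integral_smul] at h4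
      exact (smul_eq_zero.1 h4).resolve_left hr.1.ne'
    rw [setIntegral_congr_fun measurableSet_Ioc this]
    simp
  rw [iA, iB, add_zero]

/-- The Cauchy kernel `1 / (π ζ)`. -/
def cauchyKernel (ζ : ℂ) : ℂ := (Real.pi * ζ)⁻¹

/-- The singularity has order 1, less than the real dimension 2. -/
theorem locallyIntegrable_cauchyKernel : LocallyIntegrable cauchyKernel := by
  refine locallyIntegrable_of_norm_le_rpow (C := Real.pi⁻¹) (α := 1) (by simp) (by simp) ?_ ?_
  · filter_upwards with ζ
    rw [cauchyKernel, norm_inv, norm_mul, mul_inv, Real.rpow_neg_one, Complex.norm_real,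
      Real.norm_of_nonneg Real.pi_pos.le]
  · exact Measurable.aestronglyMeasurable (by unfold cauchyKernel; fun_prop)

variable {V : Type u} [NormedAddCommGroup V] [NormedSpace ℂ V]

/-- The Cauchy transform of `g` in the direction of the complex line spanned by `e`. -/
def cauchyTransform {F : Type u} [NormedAddCommGroup F] [NormedSpace ℝ F] [NormedSpace ℂ F]
    (e : V) (g : V → F) (x : V) : F :=
  ∫ ζ : ℂ, cauchyKernel ζ • g (x - ζ • e)

section

variable {F : Type u} [NormedAddCommGroup F] [NormedSpace ℝ F] [NormedSpace ℂ F]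
  [IsScalarTower ℝ ℂ F] {e : V} {ℓ : V →L[ℂ] ℂ}

theorem fderiv_eq_zero_of_supp {g : V → F} {R : ℝ} (hg : ∀ x, R < ‖ℓ x‖ → g x = 0) {x : V}
    (hx : R < ‖ℓ x‖) : fderiv ℝ g x = 0 := by
  have : g =ᶠ[𝓝 x] fun _ => 0 := by
    filter_upwards [ℓ.continuous.norm.continuousAt.eventually (lt_mem_nhds hx)] with y hy
    exact hg y hy
  rw [this.fderiv_eq]
  simp

/-- Confines the Cauchy integral to one disc that serves all `x` with `‖ℓ x‖ ≤ m`. This makes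
locally uniform bounds possible although `g` is compactly supported only in the ℓ-direction. -/
theorem apply_sub_smul_eq_zero (he : ℓ e = 1) {g : V → F} {R m : ℝ}
    (hg : ∀ x, R < ‖ℓ x‖ → g x = 0) {x : V} (hx : ‖ℓ x‖ ≤ m) {ζ : ℂ}
    (hζ : ζ ∉ Metric.closedBall (0 : ℂ) (R + m)) : g (x - ζ • e) = 0 := by
  apply hg
  rw [mem_closedBall_zero_iff, not_le] at hζ
  rw [map_sub, map_smul, he, smul_eq_mul, mul_one]
  have := norm_sub_norm_le ζ (ℓ x)
  rw [norm_sub_rev] at this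
  linarith

theorem integrable_cauchyKernel_smul (he : ℓ e = 1) {g : V → F} (hgc : Continuous g) {R : ℝ}
    (hg : ∀ x, R < ‖ℓ x‖ → g x = 0) (x : V) :
    Integrable fun ζ : ℂ => cauchyKernel ζ • g (x - ζ • e) := by
  have hK := isCompact_closedBall (0 : ℂ) (R + ‖ℓ x‖)
  have h1 : IntegrableOn (fun ζ : ℂ => cauchyKernel ζ • g (x - ζ • e))
      (Metric.closedBall (0 : ℂ) (R + ‖ℓ x‖)) :=
    (locallyIntegrable_cauchyKernel.integrableOn_isCompact hK).smul_continuousOn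
      (by fun_prop : Continuous fun ζ : ℂ => g (x - ζ • e)).continuousOn hK
  refine (integrableOn_iff_integrable_of_support_subset fun ζ hζ => ?_).1 h1
  by_contra hcon
  exact hζ (by simp only [apply_sub_smul_eq_zero he hg le_rfl hcon, smul_zero])

theorem norm_cauchyTransform_le (he : ℓ e = 1) {g : V → F} {R m M : ℝ}
    (hg : ∀ x, R < ‖ℓ x‖ → g x = 0) {x : V} (hx : ‖ℓ x‖ ≤ m)
    (hM : ∀ ζ ∈ Metric.closedBall (0 : ℂ) (R + m), ‖g (x - ζ • e)‖ ≤ M) :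
    ‖cauchyTransform e g x‖
      ≤ (∫ ζ in Metric.closedBall (0 : ℂ) (R + m), ‖cauchyKernel ζ‖) * M := by
  have hK := isCompact_closedBall (0 : ℂ) (R + m)
  have h0 : cauchyTransform e g x
      = ∫ ζ in Metric.closedBall (0 : ℂ) (R + m), cauchyKernel ζ • g (x - ζ • e) := by
    refine (setIntegral_eq_integral_of_forall_compl_eq_zero fun ζ hζ => ?_).symm
    rw [apply_sub_smul_eq_zero he hg hx hζ, smul_zero]
  rw [h0, ← integral_mul_const]
  refine norm_integral_le_of_norm_le
    (((locallyIntegrable_cauchyKernel.integrableOn_isCompact hK).norm).mul_const M) ?_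
  refine (ae_restrict_iff' measurableSet_closedBall).2 (Filter.Eventually.of_forall fun ζ hζ => ?_)
  rw [norm_smul]
  gcongr
  exact hM ζ hζ

/-- In the convolution form the variable `x` enters only through `g`, so one differentiates under
the integral. On a unit ball around `x` the derivative of the integrand is dominated by a constant
times the kernel on a fixed disc. -/
theorem hasFDerivAt_cauchyTransform [FiniteDimensional ℂ V] (he : ℓ e = 1) {g : V → F}
    (hgc : ContDiff ℝ 1 g) {R : ℝ} (hg : ∀ x, R < ‖ℓ x‖ → g x = 0) (x : V) :
    HasFDerivAt (cauchyTransform e g) (cauchyTransform e (fderiv ℝ g) x) x := by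
  have : ProperSpace V := FiniteDimensional.proper ℂ V
  have hc' : Continuous (fderiv ℝ g) := hgc.continuous_fderiv one_ne_zero
  have hd : Differentiable ℝ g := hgc.differentiable one_ne_zero
  let m := ‖ℓ‖ * (‖x‖ + 1)
  let B := Metric.closedBall (0 : ℂ) (R + m)
  have hB : IsCompact B := isCompact_closedBall _ _
  obtain ⟨C, hC⟩ := (isCompact_closedBall (0 : V) (‖x‖ + 1 + |R + m| * ‖e‖)).exists_bound_of_continuousOn
    hc'.continuousOn
  have hm : ∀ y ∈ Metric.ball x 1, ‖ℓ y‖ ≤ m ∧ ‖y‖ ≤ ‖x‖ + 1 := fun y hy => by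
    have h1 : ‖y‖ ≤ ‖x‖ + 1 := by
      have := norm_le_norm_add_norm_sub' y x
      rw [mem_ball_iff_norm] at hy
      linarith
    exact ⟨(ℓ.le_opNorm y).trans (mul_le_mul_of_nonneg_left h1 (norm_nonneg _)), h1⟩
  refine hasFDerivAt_integral_of_dominated_of_fderiv_le
    (F := fun y (ζ : ℂ) => cauchyKernel ζ • g (y - ζ • e))
    (F' := fun y (ζ : ℂ) => cauchyKernel ζ • fderiv ℝ g (y - ζ • e))
    (bound := B.indicator fun ζ => ‖cauchyKernel ζ‖ * C) (Metric.ball_mem_nhds x one_pos)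
    ?_ ?_ ?_ ?_ ?_ ?_
  · exact Filter.Eventually.of_forall fun y =>
      (integrable_cauchyKernel_smul he hgc.continuous hg y).aestronglyMeasurable
  · exact integrable_cauchyKernel_smul he hgc.continuous hg x
  · exact (integrable_cauchyKernel_smul he hc'
      (fun y hy => fderiv_eq_zero_of_supp hg hy) x).aestronglyMeasurable
  · refine Filter.Eventually.of_forall fun ζ y hy => ?_
    by_cases hζ : ζ ∈ B
    · rw [indicator_of_mem hζ, norm_smul]
      refine mul_le_mul_of_nonneg_left ?_ (norm_nonneg _)
      apply hC
      rw [mem_closedBall_zero_iff]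
      refine (norm_sub_le _ _).trans ?_
      rw [norm_smul]
      have : ‖ζ‖ ≤ |R + m| := (mem_closedBall_zero_iff.1 hζ).trans (le_abs_self _)
      gcongr
      exact (hm y hy).2
    · rw [indicator_of_notMem hζ, apply_sub_smul_eq_zero he
        (fun y hy => fderiv_eq_zero_of_supp hg hy) (hm y hy).1 hζ, smul_zero, norm_zero]
  · rw [integrable_indicator_iff hB.measurableSet]
    exact ((locallyIntegrable_cauchyKernel.integrableOn_isCompact hB).norm).mul_const C
  · refine Filter.Eventually.of_forall fun ζ y _ => ?_
    have h1 : HasFDerivAt (fun y => g (y - ζ • e)) (fderiv ℝ g (y - ζ • e)) y := by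
      exact (hd (y - ζ • e)).hasFDerivAt.comp y ((hasFDerivAt_id y).sub_const (ζ • e))
    exact h1.const_smul (cauchyKernel ζ)

theorem fderiv_cauchyTransform [FiniteDimensional ℂ V] (he : ℓ e = 1) {g : V → F}
    (hgc : ContDiff ℝ 1 g) {R : ℝ} (hg : ∀ x, R < ‖ℓ x‖ → g x = 0) :
    fderiv ℝ (cauchyTransform e g) = cauchyTransform e (fderiv ℝ g) :=
  funext fun x => (hasFDerivAt_cauchyTransform he hgc hg x).fderiv

end

/-- The derivative is again a Cauchy transform, with values in `V →L[ℝ] F`. The induction therefore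
varies the target space, and `V` and `F` share a universe so that it stays within one. -/
theorem contDiff_cauchyTransform [FiniteDimensional ℂ V] {e : V} {ℓ : V →L[ℂ] ℂ} (he : ℓ e = 1)
    {R : ℝ} (n : ℕ) : ∀ {F : Type u} [NormedAddCommGroup F] [NormedSpace ℝ F] [NormedSpace ℂ F]
    [IsScalarTower ℝ ℂ F] {g : V → F}, ContDiff ℝ ∞ g → (∀ x, R < ‖ℓ x‖ → g x = 0) →
    ContDiff ℝ n (cauchyTransform e g) := by
  induction n with
  | zero =>
    intro F _ _ _ _ g hgc hg
    refine contDiff_zero.2 (continuous_iff_continuousAt.2 fun x => ?_)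
    exact (hasFDerivAt_cauchyTransform he (hgc.of_le (by simp)) hg x).continuousAt
  | succ n ih =>
    intro F _ _ _ _ g hgc hg
    push_cast
    refine (contDiff_succ_iff_fderiv).2 ⟨fun x =>
      (hasFDerivAt_cauchyTransform he (hgc.of_le (by simp)) hg x).differentiableAt, by simp, ?_⟩
    rw [fderiv_cauchyTransform he (hgc.of_le (by simp)) hg]
    exact ih (hgc.fderiv_right (by simp)) fun x hx => fderiv_eq_zero_of_supp hg hx

theorem norm_iteratedFDeriv_cauchyTransform_le [FiniteDimensional ℂ V] {e : V} {ℓ : V →L[ℂ] ℂ}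
    (he : ℓ e = 1) {R m M : ℝ} {x : V} (hx : ‖ℓ x‖ ≤ m) (n : ℕ) :
    ∀ {F : Type u} [NormedAddCommGroup F] [NormedSpace ℝ F] [NormedSpace ℂ F]
    [IsScalarTower ℝ ℂ F] {g : V → F}, ContDiff ℝ ∞ g → (∀ x, R < ‖ℓ x‖ → g x = 0) →
    (∀ ζ ∈ Metric.closedBall (0 : ℂ) (R + m), ‖iteratedFDeriv ℝ n g (x - ζ • e)‖ ≤ M) →
    ‖iteratedFDeriv ℝ n (cauchyTransform e g) x‖
      ≤ (∫ ζ in Metric.closedBall (0 : ℂ) (R + m), ‖cauchyKernel ζ‖) * M := by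
  induction n with
  | zero =>
    intro F _ _ _ _ g hgc hg hM
    simp only [norm_iteratedFDeriv_zero] at hM ⊢
    exact norm_cauchyTransform_le he hg hx hM
  | succ n ih =>
    intro F _ _ _ _ g hgc hg hM
    simp only [← norm_iteratedFDeriv_fderiv] at hM ⊢
    rw [fderiv_cauchyTransform he (hgc.of_le (by simp)) hg]
    exact ih (hgc.fderiv_right (by simp)) (fun x hx => fderiv_eq_zero_of_supp hg hx) hM

variable {F : Type u} [NormedAddCommGroup F] [NormedSpace ℝ F] [NormedSpace ℂ F]
  [IsScalarTower ℝ ℂ F] [CompleteSpace F] {e : V} {ℓ : V →L[ℂ] ℂ}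

theorem fderiv_cauchyTransform_apply [FiniteDimensional ℂ V] (he : ℓ e = 1) {g : V → F}
    (hgc : ContDiff ℝ ∞ g) {R : ℝ} (hg : ∀ x, R < ‖ℓ x‖ → g x = 0) (x v : V) :
    fderiv ℝ (cauchyTransform e g) x v = cauchyTransform e (fun y => fderiv ℝ g y v) x := by
  rw [fderiv_cauchyTransform he (hgc.of_le (by simp)) hg, cauchyTransform,
    ContinuousLinearMap.integral_apply]
  · rfl
  · exact integrable_cauchyKernel_smul he (hgc.continuous_fderiv (by simp))
      (fun y hy => fderiv_eq_zero_of_supp hg hy) x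

theorem dbarDir_cauchyTransform_eq [FiniteDimensional ℂ V] (he : ℓ e = 1) {g : V → F}
    (hgc : ContDiff ℝ ∞ g) {R : ℝ} (hg : ∀ x, R < ‖ℓ x‖ → g x = 0) (v : V) :
    dbarDir v (cauchyTransform e g) = cauchyTransform e (dbarDir v g) := by
  funext x
  have hi : ∀ w : V, Integrable fun ζ : ℂ => cauchyKernel ζ • fderiv ℝ g (x - ζ • e) w := fun w =>
    integrable_cauchyKernel_smul he
      ((hgc.continuous_fderiv (by simp)).clm_apply continuous_const)
      (fun y hy => by rw [fderiv_eq_zero_of_supp hg hy]; rfl) x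
  rw [dbarDir, fderiv_cauchyTransform_apply he hgc hg, fderiv_cauchyTransform_apply he hgc hg]
  simp only [cauchyTransform, dbarDir]
  rw [← integral_smul, ← integral_add (hi _)
    (g := fun ζ => Complex.I • cauchyKernel ζ • fderiv ℝ g (x - ζ • e) (Complex.I • v))
    ((hi _).smul Complex.I), ← integral_smul]
  congr 1
  funext ζ
  simp only [smul_comm (cauchyKernel ζ), smul_add]

/-- The Cauchy transform solves the `∂̄`-equation in the direction `e`. -/
theorem dbarDir_cauchyTransform [FiniteDimensional ℂ V] (he : ℓ e = 1) {g : V → F}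
    (hgc : ContDiff ℝ ∞ g) {R : ℝ} (hg : ∀ x, R < ‖ℓ x‖ → g x = 0) :
    dbarDir e (cauchyTransform e g) = g := by
  rw [dbarDir_cauchyTransform_eq he hgc hg]
  funext x
  let h : ℂ → F := fun ζ => g (x - ζ • e)
  have hhc : ContDiff ℝ 1 h := by
    have : ContDiff ℝ 1 fun ζ : ℂ => x - ζ • e := by fun_prop
    exact (hgc.of_le (by simp)).comp this
  have hR : 0 < |R + ‖ℓ x‖| + 1 := by positivity
  have key := integral_inv_smul_dbar hhc hR fun ζ hζ =>
    apply_sub_smul_eq_zero he hg le_rfl (by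
      rw [mem_closedBall_zero_iff, not_le]
      linarith [le_abs_self (R + ‖ℓ x‖)])
  have hd : ∀ ζ w : ℂ, fderiv ℝ h ζ w = -fderiv ℝ g (x - ζ • e) (w • e) := fun ζ w => by
    have h1 : HasFDerivAt (fun ζ : ℂ => x - ζ • e)
        (-((ContinuousLinearMap.id ℂ ℂ).smulRight e).restrictScalars ℝ) ζ := by
      simpa using (((ContinuousLinearMap.id ℂ ℂ).smulRight e).restrictScalars
        ℝ).hasFDerivAt.const_sub x
    have h2 := (((hgc.differentiable (by simp)) (x - ζ • e)).hasFDerivAt.comp ζ h1).fderiv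
    change fderiv ℝ (g ∘ fun ζ : ℂ => x - ζ • e) ζ w = _
    rw [h2]
    simp
  simp only [hd, one_smul] at key
  have hx : h 0 = g x := by simp [h]
  rw [hx] at key
  have hsm : ∀ (r : ℝ) (y : F), (r : ℂ) • y = r • y := fun r y => algebraMap_smul ℂ r y
  have hpi : (2 * Real.pi : ℂ) ≠ 0 := by exact_mod_cast (by positivity : 2 * Real.pi ≠ 0)
  rw [cauchyTransform]
  -- The 1/2 of `dbarDir` and the 1/π of the kernel make the 1/(2π) of Cauchy–Pompeiu; the sign
  -- comes from the chain rule for `x - ζ • e`.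
  have h3 : ∀ ζ : ℂ, cauchyKernel ζ • dbarDir e g (x - ζ • e)
      = (-(2 * Real.pi : ℂ)⁻¹) • (ζ⁻¹ • (-fderiv ℝ g (x - ζ • e) e +
        Complex.I • -fderiv ℝ g (x - ζ • e) (Complex.I • e))) := fun ζ => by
    rw [dbarDir, cauchyKernel, smul_smul, smul_smul, smul_neg, ← neg_add, smul_neg, ← neg_smul]
    congr 1
    rw [mul_inv, mul_inv]
    ring
  simp only [h3]
  rw [integral_smul, key, ← hsm, smul_neg, neg_smul, neg_neg, smul_smul]
  push_cast
  rw [inv_mul_cancel₀ hpi, one_smul]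

end CauchyTransform

/-! ### Smoothness of series, and derivatives of high powers -/

section Series

/-- On each ball, the tail of each derived series of `∑ u k` is dominated by a summable sequence. -/
def LocallySummableDerivs {E F : Type*} [NormedAddCommGroup E] [NormedSpace ℝ E]
    [NormedAddCommGroup F] [NormedSpace ℝ F] (u : ℕ → E → F) : Prop :=
  ∀ (R : ℝ) (J : ℕ), ∃ (K : ℕ) (v : ℕ → ℝ), Summable v ∧ ∀ k, K ≤ k → ∀ j ≤ J, ∀ x, ‖x‖ < R →
    ‖iteratedFDeriv ℝ j (u k) x‖ ≤ v k

section

variable {E F : Type*} [NormedAddCommGroup E] [NormedSpace ℝ E] [NormedAddCommGroup F]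
  [NormedSpace ℝ F] {u : ℕ → E → F}

theorem LocallySummableDerivs.summable [CompleteSpace F] (h : LocallySummableDerivs u) (x : E) :
    Summable fun k => u k x := by
  obtain ⟨K, v, hv, hK⟩ := h (‖x‖ + 1) 0
  refine (summable_nat_add_iff K).1 (Summable.of_norm_bounded ((summable_nat_add_iff K).2 hv)
    fun k => ?_)
  simpa using hK (k + K) (Nat.le_add_left _ _) 0 le_rfl x (lt_add_one _)

theorem LocallySummableDerivs.fderiv (h : LocallySummableDerivs u) :
    LocallySummableDerivs fun k => fderiv ℝ (u k) := by
  intro R J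
  obtain ⟨K, v, hv, hK⟩ := h R (J + 1)
  refine ⟨K, v, hv, fun k hk j hj x hx => ?_⟩
  rw [norm_iteratedFDeriv_fderiv]
  exact hK k hk (j + 1) (Nat.succ_le_succ hj) x hx

/-- Only the tail from `K` on is dominated near `x`; the first `K` terms are split off as a finite
sum. -/
theorem LocallySummableDerivs.hasFDerivAt_tsum [CompleteSpace F] (h : LocallySummableDerivs u)
    (hu : ∀ k, Differentiable ℝ (u k)) (x : E) :
    HasFDerivAt (fun y => ∑' k, u k y) (∑' k, _root_.fderiv ℝ (u k) x) x := by
  obtain ⟨K, v, hv, hK⟩ := h (‖x‖ + 1) 1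
  have hx : x ∈ Metric.ball (0 : E) (‖x‖ + 1) := by simp
  have h1 : HasFDerivAt (fun y => ∑' k, u (k + K) y) (∑' k, _root_.fderiv ℝ (u (k + K)) x) x := by
    refine hasFDerivAt_tsum_of_isPreconnected ((summable_nat_add_iff K).2 hv) Metric.isOpen_ball
      (convex_ball _ _).isPreconnected (fun k y _ => (hu _ y).hasFDerivAt) (fun k y hy => ?_) hx
      ((summable_nat_add_iff K).2 (h.summable x)) hx
    have := hK (k + K) (Nat.le_add_left _ _) 1 le_rfl y (by simpa using hy)
    rwa [← zero_add 1, ← norm_iteratedFDeriv_fderiv, norm_iteratedFDeriv_zero] at this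
  have h2 : HasFDerivAt (fun y => ∑ k ∈ Finset.range K, u k y)
      (∑ k ∈ Finset.range K, _root_.fderiv ℝ (u k) x) x :=
    HasFDerivAt.fun_sum fun k _ => (hu k x).hasFDerivAt
  rw [← (h.fderiv.summable x).sum_add_tsum_nat_add K]
  simp only [fun y => ((h.summable y).sum_add_tsum_nat_add K).symm]
  exact h2.add h1

end

theorem LocallySummableDerivs.contDiff_tsum {E : Type u} [NormedAddCommGroup E] [NormedSpace ℝ E]
    (n : ℕ) : ∀ {F : Type u} [NormedAddCommGroup F] [NormedSpace ℝ F] [CompleteSpace F]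
    {u : ℕ → E → F}, LocallySummableDerivs u → (∀ k, ContDiff ℝ ∞ (u k)) →
    ContDiff ℝ n fun y => ∑' k, u k y := by
  induction n with
  | zero =>
    intro F _ _ _ u h hu
    exact contDiff_zero.2 (continuous_iff_continuousAt.2 fun x =>
      (h.hasFDerivAt_tsum (fun k => (hu k).differentiable (by simp)) x).continuousAt)
  | succ n ih =>
    intro F _ _ _ u h hu
    have hd := h.hasFDerivAt_tsum fun k => (hu k).differentiable (by simp)
    push_cast
    refine contDiff_succ_iff_fderiv.2 ⟨fun x => (hd x).differentiableAt, by simp, ?_⟩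
    rw [funext fun x => (hd x).fderiv]
    exact ih h.fderiv fun k => (hu k).fderiv_right (by simp)

/-- The derivatives of the powers of a function bounded by `θ` on a compact set decay at any
exponential rate larger than `θ`. -/
theorem exists_bound_iteratedFDeriv_pow {E : Type*} [NormedAddCommGroup E] [NormedSpace ℝ E]
    {q : E → ℂ} (hq : ContDiff ℝ ∞ q) {K : Set E} (hK : IsCompact K) {θ : ℝ} (hθ0 : 0 ≤ θ)
    (hθ : ∀ x ∈ K, ‖q x‖ ≤ θ) (j : ℕ) : ∀ θ' > θ, ∃ C, 0 ≤ C ∧ ∀ (N : ℕ), ∀ x ∈ K,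
      ‖iteratedFDeriv ℝ j (fun y => q y ^ N) x‖ ≤ C * θ' ^ N := by
  induction j using Nat.strong_induction_on with
  | _ j ih =>
  intro θ' hθ'
  rcases j with _ | j
  · refine ⟨1, zero_le_one, fun N x hx => ?_⟩
    rw [norm_iteratedFDeriv_zero, norm_pow, one_mul]
    gcongr
    exact (hθ x hx).trans hθ'.le
  -- One derivative of q^N produces N q^(N-1) dq. The induction hypothesis is used at the smaller
  -- rate `t`, and the gap between `t` and `θ'` absorbs the factor N, since N (t/θ')^N is bounded.
  · obtain ⟨t, ht, ht'⟩ := exists_between hθ'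
    have ht0 : 0 < t := hθ0.trans_lt ht
    have hθ'0 : 0 < θ' := ht0.trans ht'
    choose! C hC0 hC using fun i (hi : i < j + 1) => ih i hi t ht
    have hdq : ContDiff ℝ ∞ (fderiv ℝ q) := hq.fderiv_right (by simp)
    choose A hA using fun i : ℕ => hK.exists_bound_of_continuousOn
      ((hdq.continuous_iteratedFDeriv (m := i) (by exact_mod_cast le_top)).continuousOn)
    obtain ⟨D, hD⟩ := (tendsto_self_mul_const_pow_of_lt_one (r := t / θ')
      (by positivity) ((div_lt_one hθ'0).2 ht')).bddAbove_range
    have hD' : ∀ N : ℕ, N * t ^ (N - 1) ≤ D / t * θ' ^ N := fun N => by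
      rcases N with _ | N
      · have : 0 ≤ D := by simpa using hD ⟨0, rfl⟩
        simp
        positivity
      · have := hD ⟨N + 1, rfl⟩
        simp only [div_pow] at this
        rw [← mul_div_assoc, div_le_iff₀ (by positivity)] at this
        rw [div_mul_eq_mul_div, le_div_iff₀ ht0, Nat.add_sub_cancel, mul_assoc, ← pow_succ]
        exact this
    let S := ∑ i ∈ Finset.range (j + 1), (j.choose i : ℝ) * C i * |A (j - i)|
    have hS : 0 ≤ S := Finset.sum_nonneg fun i hi =>
      mul_nonneg (mul_nonneg (by positivity) (hC0 i (Finset.mem_range.1 hi))) (abs_nonneg _)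
    have hDt : 0 ≤ D / t := by simpa using hD' 0
    refine ⟨S * (D / t), by positivity, fun N x hx => ?_⟩
    have hfd : fderiv ℝ (fun y => q y ^ N)
        = (N : ℝ) • fun y => (q y ^ (N - 1)) • fderiv ℝ q y := by
      funext y
      rw [fderiv_fun_pow N ((hq.differentiable (by simp)) y)]
      ext v
      simp [mul_assoc]
    have hsm : ContDiff ℝ ∞ fun y => (q y ^ (N - 1)) • fderiv ℝ q y := (hq.pow _).smul hdq
    have hj : (j : WithTop ℕ∞) ≤ ∞ := by exact_mod_cast le_top
    rw [← norm_iteratedFDeriv_fderiv, hfd, iteratedFDeriv_const_smul_apply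
      (hsm.contDiffAt.of_le hj), norm_smul, Real.norm_natCast]
    calc (N : ℝ) * ‖iteratedFDeriv ℝ j (fun y => (q y ^ (N - 1)) • fderiv ℝ q y) x‖
        ≤ N * ∑ i ∈ Finset.range (j + 1), (j.choose i : ℝ) *
            ‖iteratedFDeriv ℝ i (fun y => q y ^ (N - 1)) x‖ *
            ‖iteratedFDeriv ℝ (j - i) (fderiv ℝ q) x‖ := by
          gcongr
          exact norm_iteratedFDeriv_smul_le (hq.pow _) hdq x hj
      _ ≤ N * ∑ i ∈ Finset.range (j + 1), (j.choose i : ℝ) * (C i * t ^ (N - 1)) *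
            |A (j - i)| := by
          gcongr with i hi
          · exact mul_nonneg (by positivity) (mul_nonneg (hC0 i (Finset.mem_range.1 hi))
              (by positivity))
          · exact hC i (Finset.mem_range.1 hi) _ x hx
          · exact (hA _ x hx).trans (le_abs_self _)
      _ = S * (N * t ^ (N - 1)) := by
          simp only [S, Finset.mul_sum, Finset.sum_mul]
          exact Finset.sum_congr rfl fun i _ => by ring
      _ ≤ S * (D / t * θ' ^ N) := by exact mul_le_mul_of_nonneg_left (hD' N) hS
      _ = S * (D / t) * θ' ^ N := by ring

end Series

/-! ### Rules for the antiholomorphic directional derivative -/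

section

variable {V : Type u} [NormedAddCommGroup V] [NormedSpace ℂ V]
  {F : Type u} [NormedAddCommGroup F] [NormedSpace ℝ F] [NormedSpace ℂ F]

theorem dbarDir_smul [IsScalarTower ℝ ℂ F] {c : V → ℂ} {w : V → F} {x : V}
    (hc : DifferentiableAt ℝ c x) (hw : DifferentiableAt ℝ w x) (v : V) :
    dbarDir v (fun y => c y • w y) x = c x • dbarDir v w x + dbarDir v c x • w x := by
  simp only [dbarDir, fderiv_fun_smul hc hw, add_apply, smul_apply,
    ContinuousLinearMap.smulRight_apply, smul_eq_mul]
  module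

theorem dbarDir_of_differentiableAt {c : V → ℂ} {x : V} (hc : DifferentiableAt ℂ c x) (v : V) :
    dbarDir v c x = 0 := by
  rw [dbarDir, hc.fderiv_restrictScalars ℝ]
  simp [← mul_assoc]

theorem dbarDir_comp_of_apply_eq_zero {q : ℂ → ℂ} (hq : Differentiable ℝ q) (ℓ : V →L[ℂ] ℂ)
    {v : V} (hv : ℓ v = 0) (x : V) : dbarDir v (fun y => q (ℓ y)) x = 0 := by
  have h : fderiv ℝ (fun y => q (ℓ y)) x = (fderiv ℝ q (ℓ x)).comp (ℓ.restrictScalars ℝ) :=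
    ((hq (ℓ x)).hasFDerivAt.comp x (ℓ.restrictScalars ℝ).hasFDerivAt).fderiv
  simp [dbarDir, h, hv]

theorem LocallySummableDerivs.hasSum_dbarDir [CompleteSpace F] {u : ℕ → V → F}
    (h : LocallySummableDerivs u) (hu : ∀ k, Differentiable ℝ (u k)) (v x : V) :
    HasSum (fun k => dbarDir v (u k) x) (dbarDir v (fun y => ∑' k, u k y) x) := by
  have h1 := (h.fderiv.summable x).hasSum
  have h2 : ∀ w : V, HasSum (fun k => _root_.fderiv ℝ (u k) x w)
      (_root_.fderiv ℝ (fun y => ∑' k, u k y) x w) := fun w => by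
    rw [(h.hasFDerivAt_tsum hu x).fderiv]
    exact h1.mapL (ContinuousLinearMap.apply ℝ F w)
  exact ((h2 v).add ((h2 (Complex.I • v)).const_smul Complex.I)).const_smul (1 / 2 : ℂ)

end

/-! ### Solving the ∂̄-equation in one direction -/

section Solve

variable {V : Type u} [NormedAddCommGroup V] [NormedSpace ℂ V] [FiniteDimensional ℂ V]
  {F : Type u} [NormedAddCommGroup F] [NormedSpace ℝ F] [NormedSpace ℂ F] [IsScalarTower ℝ ℂ F]
  [CompleteSpace F] {e : V} {ℓ : V →L[ℂ] ℂ}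

/-- `u` solves the `∂̄`-equation with right-hand side `g` in the direction `e`, and inherits from
`g` the holomorphy in the directions of `ker ℓ` as well as all linear relations satisfied by the
values. -/
structure IsDbarSolution (e : V) (ℓ : V →L[ℂ] ℂ) (g u : V → F) : Prop where
  contDiff : ContDiff ℝ ∞ u
  dbarDir_eq : dbarDir e u = g
  dbarDir_eq_zero : ∀ v, ℓ v = 0 → dbarDir v g = 0 → dbarDir v u = 0
  apply_eq_zero : ∀ A : F →L[ℂ] ℂ, (∀ x, A (g x) = 0) → ∀ x, A (u x) = 0

theorem contDiff_comp_functional {q : ℂ → ℂ} (hq : ContDiff ℝ ∞ q) (ℓ : V →L[ℂ] ℂ) :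
    ContDiff ℝ ∞ fun x => q (ℓ x) :=
  hq.comp (ℓ.restrictScalars ℝ).contDiff

theorem dbarDir_smul_eq_zero {q : ℂ → ℂ} (hq : ContDiff ℝ ∞ q) {g : V → F}
    (hg : ContDiff ℝ ∞ g) {v : V} (hv : ℓ v = 0) (hgv : dbarDir v g = 0) :
    dbarDir v (fun x => q (ℓ x) • g x) = 0 := by
  funext x
  rw [dbarDir_smul ((contDiff_comp_functional hq ℓ).differentiable (by simp) x)
    (hg.differentiable (by simp) x), hgv,
    dbarDir_comp_of_apply_eq_zero (hq.differentiable (by simp)) ℓ hv]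
  simp

/-- The holomorphic factor `P ∘ ℓ` passes through ∂̄, and `P * Q` acts on `g` as 1. Both factors are
constant along `ker ℓ`, and linear functionals commute with the integral, so holomorphy and linear
relations persist. The free choice of `P` and `Q` is what allows small solutions. -/
theorem isDbarSolution_smul_cauchyTransform (he : ℓ e = 1) {g : V → F} (hgc : ContDiff ℝ ∞ g)
    {R : ℝ} (hg : ∀ x, R < ‖ℓ x‖ → g x = 0) {P Q : ℂ → ℂ} (hP : ContDiff ℂ ∞ P)
    (hQ : ContDiff ℝ ∞ Q) (hPQ : ∀ x, P (ℓ x) • Q (ℓ x) • g x = g x) :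
    IsDbarSolution e ℓ g fun x => P (ℓ x) • cauchyTransform e (fun y => Q (ℓ y) • g y) x := by
  have hw : ContDiff ℝ ∞ fun y => Q (ℓ y) • g y := (contDiff_comp_functional hQ ℓ).smul hgc
  have hws : ∀ x, R < ‖ℓ x‖ → Q (ℓ x) • g x = 0 := fun x hx => by rw [hg x hx, smul_zero]
  have hT : ContDiff ℝ ∞ (cauchyTransform e fun y => Q (ℓ y) • g y) :=
    contDiff_infty.2 fun n => contDiff_cauchyTransform he n hw hws
  have hPr : ContDiff ℝ ∞ P := hP.restrict_scalars ℝ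
  have hPd : Differentiable ℂ fun x => P (ℓ x) :=
    (hP.differentiable (by simp)).comp ℓ.differentiable
  refine ⟨(contDiff_comp_functional hPr ℓ).smul hT, ?_, fun v hv hgv => ?_, fun A hA x => ?_⟩
  · funext x
    rw [dbarDir_smul ((contDiff_comp_functional hPr ℓ).differentiable (by simp) x)
      (hT.differentiable (by simp) x), dbarDir_cauchyTransform he hw hws,
      dbarDir_of_differentiableAt (hPd x), zero_smul, add_zero, hPQ]
  · refine dbarDir_smul_eq_zero hPr hT hv ?_
    rw [dbarDir_cauchyTransform_eq he hw hws, dbarDir_smul_eq_zero hQ hgc hv hgv]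
    funext x
    simp [cauchyTransform]
  · rw [map_smul, cauchyTransform, ← ContinuousLinearMap.integral_comp_comm]
    · simp [hA]
    · exact integrable_cauchyKernel_smul he hw.continuous hws x

/-- A smooth bounded modification of `s / ζ` near the origin. -/
theorem exists_contDiff_eq_div {s t a : ℝ} (hs : 0 ≤ s) (ht : 0 < t) (ha : t < a) :
    ∃ q : ℂ → ℂ, ContDiff ℝ ∞ q ∧ (∀ ζ, ‖q ζ‖ ≤ s / t) ∧ ∀ ζ, a ≤ ‖ζ‖ → q ζ = s / ζ := by
  let b : ContDiffBump (0 : ℂ) := ⟨t, a, ht, ha⟩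
  have hb0 : ∀ ζ : ℂ, ‖ζ‖ ≤ t → b ζ = 1 := fun ζ hζ =>
    b.one_of_mem_closedBall (mem_closedBall_zero_iff.2 hζ)
  refine ⟨fun ζ => ((1 - b ζ : ℝ) : ℂ) * (s / ζ), ?_, fun ζ => ?_, fun ζ hζ => ?_⟩
  · rw [contDiff_iff_contDiffAt]
    intro ζ
    rcases eq_or_ne ζ 0 with rfl | hζ
    · refine (contDiffAt_const (c := (0 : ℂ))).congr_of_eventuallyEq ?_
      filter_upwards [Metric.closedBall_mem_nhds (0 : ℂ) ht] with y hy
      simp [hb0 y (mem_closedBall_zero_iff.1 hy)]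
    · simp only [div_eq_mul_inv]
      refine ContDiffAt.mul ?_ (contDiffAt_const.mul (contDiffAt_inv ℝ hζ))
      exact Complex.ofRealCLM.contDiff.contDiffAt.comp ζ (contDiffAt_const.sub b.contDiffAt)
  · by_cases hζ : ‖ζ‖ ≤ t
    · simp only [hb0 ζ hζ, sub_self, Complex.ofReal_zero, zero_mul, norm_zero]
      positivity
    · push Not at hζ
      beta_reduce
      rw [norm_mul, Complex.norm_real, norm_div, Complex.norm_real, Real.norm_of_nonneg hs,
        Real.norm_of_nonneg (by linarith [b.le_one (x := ζ)])]
      calc (1 - b ζ) * (s / ‖ζ‖) ≤ 1 * (s / t) := by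
            gcongr
            linarith [b.nonneg (x := ζ)]
        _ = s / t := one_mul _
  · have : b ζ = 0 := b.zero_of_le_dist (by simpa using hζ)
    simp [this]

/-- If the right-hand side vanishes near the zero set of `ℓ`, the `∂̄`-equation has solutions that
are arbitrarily small on bounded sets there, together with their derivatives. -/
theorem exists_isDbarSolution_norm_le (he : ℓ e = 1) {g : V → F} (hgc : ContDiff ℝ ∞ g) {R : ℝ}
    (hg : ∀ x, R < ‖ℓ x‖ → g x = 0) {a : ℝ} (hga : ∀ x, ‖ℓ x‖ < a → g x = 0) (m : ℝ) (J : ℕ)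
    {ε : ℝ} (hε : 0 < ε) :
    ∃ u, IsDbarSolution e ℓ g u ∧
      ∀ x, ‖x‖ ≤ m → ‖ℓ x‖ ≤ a - 1 → ∀ j ≤ J, ‖iteratedFDeriv ℝ j u x‖ ≤ ε := by
  have : ProperSpace V := FiniteDimensional.proper ℂ V
  rcases lt_or_ge a 1 with ha | ha
  -- For a < 1 no `x` satisfies `‖ℓ x‖ ≤ a - 1`, so any solution will do.
  · refine ⟨_, isDbarSolution_smul_cauchyTransform he hgc hg (P := fun _ => 1) (Q := fun _ => 1)
      contDiff_const contDiff_const (fun x => by simp), fun x _ hx => ?_⟩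
    linarith [norm_nonneg (ℓ x)]
  -- The radii satisfy a - 1 < s < t < a. With `q` equal to s/ζ for `|ζ| ≥ a` and bounded by s/t <
  -- 1, the powers of `q` inside the transform stay bounded with their derivatives, uniformly in N.
  -- The outer factor (ℓ/s)^N decays exponentially where `‖ℓ x‖ ≤ a - 1`.
  let s := a - 2 / 3
  let t := a - 1 / 3
  have hs : 0 < s := by simp only [s]; linarith
  have ht : 0 < t := by simp only [t]; linarith
  have hst : s < t := by simp only [s, t]; linarith
  obtain ⟨q, hqc, hqn, hqa⟩ := exists_contDiff_eq_div hs.le ht (by simp only [t]; linarith : t < a)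
  let u : ℕ → V → F := fun N x =>
    (ℓ x / s) ^ N • cauchyTransform e (fun y => q (ℓ y) ^ N • g y) x
  have hsC : (s : ℂ) ≠ 0 := by exact_mod_cast hs.ne'
  have hu : ∀ N, IsDbarSolution e ℓ g (u N) := fun N => by
    refine isDbarSolution_smul_cauchyTransform he hgc hg (P := fun z => (z / s) ^ N)
      (Q := fun z => q z ^ N) (by fun_prop) (hqc.pow N) fun x => ?_
    rcases lt_or_ge ‖ℓ x‖ a with hx | hx
    · simp [hga x hx]
    · have h0 : ℓ x ≠ 0 := fun h0 => by
        rw [h0, norm_zero] at hx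
        linarith
      rw [hqa _ hx, smul_smul, ← mul_pow]
      have : ℓ x / s * (s / ℓ x) = 1 := by field_simp
      rw [this, one_pow, one_smul]
  let L := ‖ℓ‖ * m
  let r := m + |R + L| * ‖e‖
  have hK := isCompact_closedBall (0 : V) r
  have hq' : ContDiff ℝ ∞ fun x => q (ℓ x) := contDiff_comp_functional hqc ℓ
  have hst1 : s / t < 1 := (div_lt_one ht).2 hst
  choose C hC0 hC using fun i : ℕ => exists_bound_iteratedFDeriv_pow hq' hK (by positivity)
    (fun x _ => hqn (ℓ x)) i 1 hst1
  choose A hA using fun i : ℕ => hK.exists_bound_of_continuousOn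
    ((hgc.continuous_iteratedFDeriv (m := i) (by exact_mod_cast le_top)).continuousOn)
  let M : ℕ → ℝ := fun j => ∑ i ∈ Finset.range (j + 1), (j.choose i : ℝ) * C i * |A (j - i)|
  have hM0 : ∀ j, 0 ≤ M j := fun j => Finset.sum_nonneg fun i _ =>
    mul_nonneg (mul_nonneg (by positivity) (hC0 i)) (abs_nonneg _)
  have hM : ∀ j N, ∀ x ∈ Metric.closedBall (0 : V) r,
      ‖iteratedFDeriv ℝ j (fun y => q (ℓ y) ^ N • g y) x‖ ≤ M j := fun j N x hx => by
    refine (norm_iteratedFDeriv_smul_le (hq'.pow N) hgc x (by exact_mod_cast le_top)).trans ?_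
    refine Finset.sum_le_sum fun i _ => ?_
    have h1 := hC i N x hx
    rw [one_pow, mul_one] at h1
    have h2 := (hA (j - i) x hx).trans (le_abs_self _)
    exact mul_le_mul (mul_le_mul_of_nonneg_left h1 (by positivity)) h2 (norm_nonneg _)
      (mul_nonneg (by positivity) (hC0 i))
  let κ := ∫ ζ in Metric.closedBall (0 : ℂ) (R + L), ‖cauchyKernel ζ‖
  have hκ : 0 ≤ κ := MeasureTheory.integral_nonneg fun _ => norm_nonneg _
  have hT : ∀ j N x, ‖x‖ ≤ m → ‖iteratedFDeriv ℝ j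
      (cauchyTransform e fun y => q (ℓ y) ^ N • g y) x‖ ≤ κ * M j := fun j N x hx => by
    refine norm_iteratedFDeriv_cauchyTransform_le (m := L) he ((ℓ.le_opNorm x).trans
      (mul_le_mul_of_nonneg_left hx (norm_nonneg _))) j ((hq'.pow N).smul hgc)
      (fun y hy => by rw [hg y hy, smul_zero]) fun ζ hζ => hM j N _ ?_
    rw [mem_closedBall_zero_iff] at hζ ⊢
    refine (norm_sub_le _ _).trans ?_
    rw [norm_smul]
    exact add_le_add hx (mul_le_mul_of_nonneg_right (hζ.trans (le_abs_self _)) (norm_nonneg _))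
  have hp : ContDiff ℝ ∞ fun x : V => ℓ x / s :=
    contDiff_comp_functional (q := fun z => z / s) (by fun_prop) ℓ
  let K' := Metric.closedBall (0 : V) m ∩ {x | ‖ℓ x‖ ≤ a - 1}
  have hK' : IsCompact K' := (isCompact_closedBall _ _).inter_right
    (isClosed_le ℓ.continuous.norm continuous_const)
  have has : (a - 1) / s < 1 := (div_lt_one hs).2 (by simp only [s]; linarith)
  obtain ⟨ρ, hρ, hρ1⟩ := exists_between has
  have hρ0 : 0 ≤ (a - 1) / s := div_nonneg (by linarith) hs.le
  choose C' hC0' hC' using fun i : ℕ => exists_bound_iteratedFDeriv_pow hp hK' hρ0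
    (fun x hx => by
      rw [norm_div, Complex.norm_real, Real.norm_of_nonneg hs.le]
      exact div_le_div_of_nonneg_right hx.2 hs.le) i ρ hρ
  let S : ℕ → ℝ := fun j => ∑ i ∈ Finset.range (j + 1), (j.choose i : ℝ) * C' i * (κ * M (j - i))
  have hS0 : ∀ j, 0 ≤ S j := fun j => Finset.sum_nonneg fun i _ =>
    mul_nonneg (mul_nonneg (by positivity) (hC0' i)) (mul_nonneg hκ (hM0 _))
  have hS : ∀ j N, ∀ x ∈ K', ‖iteratedFDeriv ℝ j (u N) x‖ ≤ S j * ρ ^ N := fun j N x hx => by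
    have hw : ContDiff ℝ ∞ fun y => q (ℓ y) ^ N • g y := (hq'.pow N).smul hgc
    have hTc : ContDiff ℝ ∞ (cauchyTransform e fun y => q (ℓ y) ^ N • g y) :=
      contDiff_infty.2 fun n => contDiff_cauchyTransform he n hw
        fun y hy => by rw [hg y hy, smul_zero]
    refine (norm_iteratedFDeriv_smul_le (hp.pow N) hTc x (by exact_mod_cast le_top)).trans ?_
    rw [Finset.sum_mul]
    refine Finset.sum_le_sum fun i _ => ?_
    have h1 := hC' i N x hx
    have h2 := hT (j - i) N x (mem_closedBall_zero_iff.1 hx.1)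
    calc _ ≤ (j.choose i : ℝ) * (C' i * ρ ^ N) * (κ * M (j - i)) := by
          refine mul_le_mul (mul_le_mul_of_nonneg_left h1 (by positivity)) h2 (norm_nonneg _)
            (mul_nonneg (by positivity)
              (mul_nonneg (hC0' i) (pow_nonneg (hρ0.trans hρ.le) _)))
      _ = _ := by ring
  have hlim : Filter.Tendsto (fun N : ℕ => (∑ j ∈ Finset.range (J + 1), S j) * ρ ^ N) Filter.atTop
      (𝓝 0) := by
    simpa using (tendsto_pow_atTop_nhds_zero_of_lt_one (hρ0.trans hρ.le) hρ1).const_mul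
      (∑ j ∈ Finset.range (J + 1), S j)
  obtain ⟨N, hN⟩ := (hlim.eventually (gt_mem_nhds hε)).exists
  refine ⟨u N, hu N, fun x hx hxa j hj => (hS j N x ⟨by simpa using hx, hxa⟩).trans ?_⟩
  refine le_trans ?_ hN.le
  refine mul_le_mul_of_nonneg_right ?_ (pow_nonneg (hρ0.trans hρ.le) _)
  exact Finset.single_le_sum (fun i _ => hS0 i) (Finset.mem_range.2 (Nat.lt_succ_of_le hj))

/-- Global solvability of the `∂̄`-equation in one direction, with smooth dependence on the
remaining variables. -/
theorem exists_isDbarSolution (he : ℓ e = 1) {f : V → F} (hf : ContDiff ℝ ∞ f) :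
    ∃ u, IsDbarSolution e ℓ f u := by
  let b : ℕ → ContDiffBump (0 : ℂ) := fun k =>
    ⟨k + 1, k + 2, by positivity, by linarith⟩
  let θ : ℕ → ℂ → ℂ := fun k z => ((b k z : ℝ) : ℂ)
  have hθ : ∀ k, ContDiff ℝ ∞ (θ k) := fun k => Complex.ofRealCLM.contDiff.comp (b k).contDiff
  have hθ1 : ∀ (k : ℕ) (z : ℂ), ‖z‖ ≤ k + 1 → θ k z = 1 := fun k z hz => by
    simp only [θ]
    rw [(b k).one_of_mem_closedBall (by simpa using hz), Complex.ofReal_one]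
  have hθ0 : ∀ (k : ℕ) (z : ℂ), (k : ℝ) + 2 ≤ ‖z‖ → θ k z = 0 := fun k z hz => by
    simp only [θ]
    rw [(b k).zero_of_le_dist (by simpa using hz), Complex.ofReal_zero]
  -- A partition of unity over annuli by telescoping: `χ k` lives on k ≤ |z| ≤ k + 2, and the
  -- partial sums are the cut-offs `θ n`.
  let χ : ℕ → ℂ → ℂ := fun k => Nat.casesOn k (θ 0) fun k z => θ (k + 1) z - θ k z
  have hχ : ∀ k, ContDiff ℝ ∞ (χ k) := fun k => by
    cases k with
    | zero => exact hθ 0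
    | succ k => exact (hθ (k + 1)).sub (hθ k)
  have hχR : ∀ (k : ℕ) (z : ℂ), (k : ℝ) + 2 < ‖z‖ → χ k z = 0 := fun k z hz => by
    cases k with
    | zero => exact hθ0 0 z hz.le
    | succ k =>
      push_cast at hz
      change θ (k + 1) z - θ k z = 0
      rw [hθ0 (k + 1) z (by push_cast; linarith), hθ0 k z (by linarith), sub_zero]
  have hχ0 : ∀ (k : ℕ) (z : ℂ), ‖z‖ < k → χ k z = 0 := fun k z hz => by
    cases k with
    | zero => simp at hz; linarith [norm_nonneg z]
    | succ k =>
      push_cast at hz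
      change θ (k + 1) z - θ k z = 0
      rw [hθ1 (k + 1) z (by push_cast; linarith), hθ1 k z (by linarith), sub_self]
  have hχs : ∀ z n, ∑ k ∈ Finset.range (n + 1), χ k z = θ n z := fun z n => by
    induction n with
    | zero => simp [χ]
    | succ n ih =>
      rw [Finset.sum_range_succ, ih]
      simp [χ]
  have hsum : ∀ x, HasSum (fun k => χ k (ℓ x) • f x) (f x) := fun x => by
    obtain ⟨n, hn⟩ := exists_nat_gt ‖ℓ x‖
    have h1 : HasSum (fun k => χ k (ℓ x)) (∑ k ∈ Finset.range (n + 1), χ k (ℓ x)) := by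
      refine hasSum_sum_of_ne_finset_zero fun k hk => hχ0 k _ ?_
      rw [Finset.mem_range, not_lt] at hk
      refine hn.trans ?_
      exact_mod_cast hk
    rw [hχs, hθ1 n _ (by linarith)] at h1
    simpa using h1.smul_const (f x)
  -- The k-th piece vanishes for `‖ℓ x‖ < k`, so its solution can be made smaller than 2^(-k), with
  -- derivatives up to order k, where `‖x‖ ≤ k` and `‖ℓ x‖ ≤ k - 1`. Every ball satisfies these
  -- conditions once k is large.
  choose u hu hub using fun k : ℕ => exists_isDbarSolution_norm_le he
    (g := fun x => χ k (ℓ x) • f x) ((contDiff_comp_functional (hχ k) ℓ).smul hf) (R := k + 2)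
    (fun x hx => by rw [hχR k _ hx, zero_smul]) (a := k)
    (fun x hx => by rw [hχ0 k _ hx, zero_smul]) k k (ε := (1 / 2 : ℝ) ^ k) (by positivity)
  have hloc : LocallySummableDerivs u := fun R J => by
    obtain ⟨K, hK⟩ := exists_nat_gt (max R (max J (‖ℓ‖ * R + 1)))
    refine ⟨K, fun k => (1 / 2 : ℝ) ^ k, summable_geometric_two, fun k hk j hj x hx => ?_⟩
    have hKk : (K : ℝ) ≤ k := by exact_mod_cast hk
    simp only [max_lt_iff] at hK
    refine hub k x (by linarith) ?_ j ?_
    · have := (ℓ.le_opNorm x).trans (mul_le_mul_of_nonneg_left hx.le (norm_nonneg _))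
      linarith
    · have : J < K := by exact_mod_cast hK.2.1
      omega
  have hud : ∀ k, Differentiable ℝ (u k) := fun k => (hu k).contDiff.differentiable (by simp)
  refine ⟨fun x => ∑' k, u k x,
    contDiff_infty.2 fun n => hloc.contDiff_tsum n fun k => (hu k).contDiff, ?_,
    fun v hv hfv => ?_, fun A hA x => ?_⟩
  · funext x
    have h1 := hloc.hasSum_dbarDir hud e x
    simp only [fun k => (hu k).dbarDir_eq] at h1
    exact h1.unique (hsum x)
  · funext x
    have h1 := hloc.hasSum_dbarDir hud v x
    simp only [fun k => (hu k).dbarDir_eq_zero v hv (dbarDir_smul_eq_zero (hχ k) hf hv hfv)] at h1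
    exact h1.unique (by simpa using hasSum_zero)
  · rw [A.map_tsum (hloc.summable x)]
    simp [fun k => (hu k).apply_eq_zero A (fun y => by rw [map_smul, hA, smul_zero]) x]

end Solve

/-! ### The global ∂̄-Poincaré lemma -/

section Poincare

/-- Evaluation of alternating forms at a tuple, as a complex-linear functional. -/
def evalCLM {V : Type*} [NormedAddCommGroup V] [NormedSpace ℂ V] {q : ℕ} (m : Fin q → V) :
    (V [⋀^Fin q]→L[ℝ] ℂ) →L[ℂ] ℂ where
  toFun η := η m
  map_add' _ _ := rfl
  map_smul' _ _ := rfl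
  cont := (ContinuousAlternatingMap.apply ℝ V ℂ m).continuous

variable {V : Type u} [NormedAddCommGroup V] [NormedSpace ℂ V] [FiniteDimensional ℂ V]

/-- Antilinearity is a family of complex-linear relations among the values of the form, and such
relations pass to the solution. -/
theorem IsDbarSolution.mem_form {e : V} {ℓ : V →L[ℂ] ℂ} {q : ℕ} {α η : V → V [⋀^Fin q]→L[ℝ] ℂ}
    (h : IsDbarSolution e ℓ α η) (hα : α ∈ Form V q) : η ∈ Form V q := by
  refine ⟨h.contDiff, fun x m i c v => ?_⟩
  have := h.apply_eq_zero (evalCLM (Function.update m i (c • v))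
    - (starRingEnd ℂ) c • evalCLM (Function.update m i v)) (fun y => sub_eq_zero.2 (hα.2 y m i c v))
    x
  exact sub_eq_zero.1 this

theorem IsDbarSolution.contract_eq_zero {e : V} {ℓ : V →L[ℂ] ℂ} {q : ℕ}
    {α η : V → V [⋀^Fin (q + 1)]→L[ℝ] ℂ} (h : IsDbarSolution e ℓ α η) {e' : V}
    (hα : contract e' α = 0) : contract e' η = 0 := by
  funext x
  ext m
  refine h.apply_eq_zero (evalCLM (Matrix.vecCons e' m)) (fun y => ?_) x
  exact DFunLike.congr_fun (congrFun hα y) m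

/-- By antilinearity the complex basis suffices; the real directions i e_j need no separate check.
-/
theorem eq_zero_of_contract_eq_zero {ι : Type*} [Fintype ι] [DecidableEq ι] {q : ℕ}
    {α : (ι → ℂ) → (ι → ℂ) [⋀^Fin (q + 1)]→L[ℝ] ℂ} (hα : α ∈ Form (ι → ℂ) (q + 1))
    (h : ∀ i, contract (Pi.single i 1) α = 0) : α = 0 := by
  funext x
  ext m
  have hm : m 0 = ∑ i, (m 0 i) • (Pi.single i 1 : ι → ℂ) := by
    funext j
    simp [Pi.single_apply]
  rw [← Function.update_eq_self 0 m, hm]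
  refine ((α x).toMultilinearMap.map_update_sum Finset.univ 0 (fun i => m 0 i • Pi.single i 1)
    m).trans ?_
  refine Finset.sum_eq_zero fun i _ => ?_
  refine (hα.2 x m 0 _ _).trans ?_
  have h1 : Function.update m 0 (Pi.single i 1 : ι → ℂ)
      = Matrix.vecCons (Pi.single i 1) (fun j => m j.succ) := by
    funext j
    refine Fin.cases ?_ (fun j => ?_) j <;> simp
  rw [h1]
  have h2 := DFunLike.congr_fun (congrFun (h i) x) (fun j => m j.succ)
  exact mul_eq_zero_of_right _ h2

/-- **The global `∂̄`-Poincaré lemma** on `ℂ^ι`. -/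
theorem exists_dbarFun_eq {ι : Type u} [Fintype ι] {q : ℕ}
    {α : (ι → ℂ) → (ι → ℂ) [⋀^Fin (q + 1)]→L[ℝ] ℂ} (hα : α ∈ Form (ι → ℂ) (q + 1))
    (hc : dbarFun α = 0) : ∃ u ∈ Form (ι → ℂ) q, dbarFun u = α := by
  classical
  -- The coordinates in `S` are those whose dz̄ has already been eliminated from the remainder.
  suffices h : ∀ S : Finset ι, ∃ u ∈ Form (ι → ℂ) q,
      ∀ l ∈ S, contract (Pi.single l 1) (α - dbarFun u) = 0 by
    obtain ⟨u, hu, h0⟩ := h Finset.univ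
    refine ⟨u, hu, (sub_eq_zero.1 ?_).symm⟩
    exact eq_zero_of_contract_eq_zero ((Form _ _).sub_mem hα (dbarFun_mem hu))
      fun i => h0 i (Finset.mem_univ i)
  intro S
  induction S using Finset.induction_on with
  | empty => exact ⟨0, (Form _ _).zero_mem, by simp⟩
  | insert i S hi ih =>
    obtain ⟨u, hu, hS⟩ := ih
    have h1 : α - dbarFun u ∈ Form (ι → ℂ) (q + 1) := (Form _ _).sub_mem hα (dbarFun_mem hu)
    have h1d : Differentiable ℝ (α - dbarFun u) := h1.1.differentiable (by simp)
    have h1c : dbarFun (α - dbarFun u) = 0 := by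
      rw [dbarFun_sub hα.1 (dbarFun_mem hu).1, hc, dbarFun_dbarFun hu.1, sub_zero]
    obtain ⟨η, hη⟩ := exists_isDbarSolution (e := (Pi.single i 1 : ι → ℂ))
      (ℓ := ContinuousLinearMap.proj i) (by simp) h1.1
    have hηF := hη.mem_form h1
    have hηd : Differentiable ℝ η := hηF.1.differentiable (by simp)
    have hcη := contract_mem (Pi.single i 1 : ι → ℂ) hηF
    -- By Cartan's formula the new remainder is ι_i ∂̄η, which ι_i kills. For l in `S`, both ι_l η
    -- and D̄_l η vanish because η inherits this from the old remainder; hence ι_l ∂̄η = 0 and the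
    -- earlier progress is kept.
    have key : α - dbarFun (u + contract (Pi.single i 1) η)
        = contract (Pi.single i 1) (dbarFun η) := by
      rw [dbarFun_add hu.1 hcη.1, contract_dbarFun _ hηd, hη.dbarDir_eq, sub_add_eq_sub_sub]
    refine ⟨_, (Form _ _).add_mem hu hcη, fun l hl => ?_⟩
    rw [key]
    rcases eq_or_ne l i with rfl | hli
    · exact contract_self _ _
    have hlS : l ∈ S := (Finset.mem_insert.1 hl).resolve_left hli
    have hl1 : contract (Pi.single l 1 : ι → ℂ) η = 0 := hη.contract_eq_zero (hS l hlS)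
    have hl2 : dbarDir (Pi.single l 1 : ι → ℂ) η = 0 :=
      hη.dbarDir_eq_zero _ (by simp [hli.symm]) (dbarDir_eq_zero_of_contract h1d (hS l hlS) h1c)
    have hl3 : contract (Pi.single l 1 : ι → ℂ) (dbarFun η) = 0 := by
      rw [contract_dbarFun _ hηd, hl1, hl2, dbarFun_zero, sub_zero]
    rw [contract_comm, hl3, contract_zero, neg_zero]

end Poincare

/-! ### Complex smooth functions are analytic -/

section Analytic

open Metric

variable {V : Type*} [NormedAddCommGroup V] [NormedSpace ℂ V]

/-- Cauchy's estimate applied n times, each time giving up a margin δ. The factor 2 arises because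
the first-order estimate measures the distance to the value at the centre. -/
theorem norm_iteratedFDeriv_le_of_bound {F : Type*} [NormedAddCommGroup F] [NormedSpace ℂ F]
    {f : V → F} {c : V} {δ M : ℝ} (hδ : 0 < δ) (n : ℕ) (hM : 0 ≤ M) (hf : ContDiff ℂ ∞ f)
    (x : V) (r : ℝ) (hx : ‖x - c‖ ≤ r)
    (hb : ∀ y, ‖y - c‖ ≤ r + n * δ → ‖f y‖ ≤ M) :
    ‖iteratedFDeriv ℂ n f x‖ ≤ M * (2 / δ) ^ n := by
  induction n generalizing x r with
  | zero => simpa using hb x (by simpa using hx)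
  | succ n ih =>
    have hd : Differentiable ℂ (iteratedFDeriv ℂ n f) :=
      hf.differentiable_iteratedFDeriv (by exact_mod_cast ENat.natCast_lt_top n)
    have hball : ∀ y ∈ ball x δ, ‖iteratedFDeriv ℂ n f y‖ ≤ M * (2 / δ) ^ n := fun y hy => by
      refine ih y (r + δ) ?_ fun z hz => hb z ?_
      · have := norm_add_le (y - x) (x - c)
        rw [mem_ball_iff_norm] at hy
        rw [sub_add_sub_cancel] at this
        linarith
      · push_cast
        linarith
    have h1 : ‖fderiv ℂ (iteratedFDeriv ℂ n f) x‖ ≤ (2 * (M * (2 / δ) ^ n)) / δ := by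
      refine Complex.norm_fderiv_le_div_of_mapsTo_ball hd.differentiableOn (fun y hy => ?_) hδ
      rw [mem_closedBall_iff_norm]
      refine (norm_sub_le _ _).trans ?_
      linarith [hball y hy, hball x (mem_ball_self hδ)]
    rw [norm_fderiv_iteratedFDeriv] at h1
    refine h1.trans (le_of_eq ?_)
    rw [pow_succ]
    ring

theorem iteratedDeriv_comp_add_smul {f : V → ℂ} (hf : ContDiff ℂ ∞ f) (x v : V) (n : ℕ) :
    iteratedDeriv n (fun t : ℂ => f (x + t • v))
      = fun t => iteratedFDeriv ℂ n f (x + t • v) fun _ => v := by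
  induction n with
  | zero =>
    funext t
    simp
  | succ n ih =>
    funext t
    rw [iteratedDeriv_succ, ih]
    have hd : DifferentiableAt ℂ (iteratedFDeriv ℂ n f) (x + t • v) :=
      hf.differentiable_iteratedFDeriv (by exact_mod_cast ENat.natCast_lt_top n) _
    have hl : HasDerivAt (fun t : ℂ => x + t • v) v t := by
      simpa using ((hasDerivAt_id t).smul_const v).const_add x
    have h1 := hd.hasFDerivAt.comp_hasDerivAt t hl
    have h2 := ((ContinuousMultilinearMap.apply ℂ (fun _ : Fin n => V) ℂ
      (fun _ => v)).hasFDerivAt).comp_hasDerivAt t h1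
    refine h2.deriv.trans ?_
    rw [iteratedFDeriv_succ_apply_left]
    rfl

/-- Margins δ = 1/n bound the n-th derivative by M (2n)^n, and n^n/n! ≤ e^n then gives the Taylor
series a positive radius. Its sum is identified on complex lines through `x`, where `f` is an entire
function of one variable. -/
theorem analyticAt_of_contDiff [FiniteDimensional ℂ V] {f : V → ℂ} (hf : ContDiff ℂ ∞ f) (x : V) :
    AnalyticAt ℂ f x := by
  have : ProperSpace V := FiniteDimensional.proper ℂ V
  obtain ⟨M, hM⟩ := (isCompact_closedBall x 1).exists_bound_of_continuousOn
    hf.continuous.continuousOn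
  have hM0 : 0 ≤ M := (norm_nonneg _).trans (hM x (mem_closedBall_self zero_le_one))
  let p : FormalMultilinearSeries ℂ V ℂ := fun n => ((n.factorial : ℂ)⁻¹) • iteratedFDeriv ℂ n f x
  have hp : ∀ n, ‖p n‖ ≤ M * (2 * Real.exp 1) ^ n := fun n => by
    have h1 : ‖iteratedFDeriv ℂ n f x‖ ≤ M * (2 * n) ^ n := by
      rcases Nat.eq_zero_or_pos n with rfl | hn
      · simpa using hM x (mem_closedBall_self zero_le_one)
      · have hn' : (0 : ℝ) < n := by exact_mod_cast hn
        have := norm_iteratedFDeriv_le_of_bound (c := x) (δ := 1 / n) (by positivity) n hM0 hf x 0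
          (by simp) fun y hy => hM y (by
            rw [mem_closedBall_iff_norm]
            rwa [zero_add, mul_one_div_cancel hn'.ne'] at hy)
        simpa using this
    have h2 := Real.pow_div_factorial_le_exp (n : ℝ) (by positivity) n
    have h3 : (0 : ℝ) < n.factorial := by exact_mod_cast n.factorial_pos
    rw [norm_smul, norm_inv, Complex.norm_natCast]
    calc (n.factorial : ℝ)⁻¹ * ‖iteratedFDeriv ℂ n f x‖
        ≤ (n.factorial : ℝ)⁻¹ * (M * (2 * n) ^ n) := by gcongr
      _ = M * 2 ^ n * ((n : ℝ) ^ n / n.factorial) := by rw [mul_pow]; field_simp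
      _ ≤ M * 2 ^ n * Real.exp n := by gcongr
      _ = M * (2 * Real.exp 1) ^ n := by rw [mul_pow, ← Real.exp_nat_mul, mul_one]; ring
  let r : NNReal := ⟨(2 * Real.exp 1)⁻¹, by positivity⟩
  have hr : 0 < r := by
    rw [← NNReal.coe_pos]
    change 0 < (2 * Real.exp 1)⁻¹
    positivity
  refine ⟨p, r, ⟨?_, by exact_mod_cast hr, fun {y} _ => ?_⟩⟩
  · refine p.le_radius_of_bound M fun n => ?_
    have hrn : (r : ℝ) ^ n = ((2 * Real.exp 1) ^ n)⁻¹ := inv_pow _ _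
    rw [hrn]
    calc ‖p n‖ * ((2 * Real.exp 1) ^ n)⁻¹
        ≤ (M * (2 * Real.exp 1) ^ n) * ((2 * Real.exp 1) ^ n)⁻¹ := by
          gcongr
          exact hp n
      _ = M := by
          rw [mul_assoc, mul_inv_cancel₀ (by positivity), mul_one]
  · have hg : Differentiable ℂ fun t : ℂ => f (x + t • y) :=
      (hf.differentiable (by simp)).comp (by fun_prop)
    have h1 := Complex.hasSum_taylorSeries_of_entire hg 0 1
    simp only [iteratedDeriv_comp_add_smul hf, sub_zero, one_pow, one_smul, zero_smul,
      add_zero] at h1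
    exact h1

end Analytic

/-! ### From the Cauchy–Riemann equations to holomorphy -/

section CauchyRiemann

variable {V : Type*} [NormedAddCommGroup V] [NormedSpace ℂ V]

theorem fderiv_I_smul_of_dbarDir_eq_zero {f : V → ℂ} {v x : V} (h : dbarDir v f x = 0) :
    fderiv ℝ f x (Complex.I • v) = Complex.I * fderiv ℝ f x v := by
  have h1 : fderiv ℝ f x v + Complex.I * fderiv ℝ f x (Complex.I • v) = 0 := by
    simpa [dbarDir] using h
  linear_combination (-Complex.I) * h1 + fderiv ℝ f x (Complex.I • v) * Complex.I_mul_I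

/-- The Cauchy–Riemann equations imply complex differentiability. -/
theorem differentiable_of_dbarDir_eq_zero {f : V → ℂ} (hf : Differentiable ℝ f)
    (h : ∀ v x, dbarDir v f x = 0) : Differentiable ℂ f := by
  intro x
  rw [differentiableAt_iff_restrictScalars ℝ (hf x)]
  refine ⟨{ toFun := fderiv ℝ f x
            map_add' := map_add _
            map_smul' := fun c v => ?_
            cont := (fderiv ℝ f x).continuous }, rfl⟩
  have hc : c • v = c.re • v + c.im • (Complex.I • v) := by
    conv_lhs => rw [← Complex.re_add_im c]
    rw [add_smul, mul_smul]
    rfl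
  rw [hc, map_add, map_smul, map_smul, fderiv_I_smul_of_dbarDir_eq_zero (h v x)]
  conv_rhs => rw [RingHom.id_apply, ← Complex.re_add_im c]
  simp only [Complex.real_smul, smul_eq_mul]
  ring

theorem fderiv_eq_of_differentiable {f : V → ℂ} (hf : Differentiable ℂ f) (x v : V) :
    fderiv ℝ f x v = fderiv ℂ f x v := by
  rw [((hf x).hasFDerivAt.restrictScalars ℝ).fderiv]
  rfl

/-- By symmetry of the second derivative, D̄_v D_u f = D_u D̄_v f. This drives the induction on the
order of complex smoothness. -/
theorem dbarDir_fderiv_apply {f : V → ℂ} (hf : ContDiff ℝ ∞ f) (h : ∀ v x, dbarDir v f x = 0)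
    (u v x : V) : dbarDir v (fun y => fderiv ℝ f y u) x = 0 := by
  have hd : ContDiff ℝ ∞ (fderiv ℝ f) := hf.fderiv_right (by simp)
  have hd' : DifferentiableAt ℝ (fderiv ℝ f) x := (hd.differentiable (by simp)) x
  have hsymm : ∀ a b, fderiv ℝ (fderiv ℝ f) x a b = fderiv ℝ (fderiv ℝ f) x b a := fun a b =>
    (hf.contDiffAt (x := x)).isSymmSndFDerivAt
      (by simpa using (WithTop.coe_le_coe.2 le_top : ((2 : ℕ∞) : WithTop ℕ∞) ≤ ∞)) a b
  have hap : ∀ a b, fderiv ℝ (fun y => fderiv ℝ f y a) x b = fderiv ℝ (fderiv ℝ f) x b a :=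
    fun a b => by
      rw [((hd'.hasFDerivAt).clm_apply (hasFDerivAt_const a x)).fderiv]
      simp
  have h2 : (fun y => fderiv ℝ f y (Complex.I • v)) = fun y => Complex.I • fderiv ℝ f y v :=
    funext fun y => fderiv_I_smul_of_dbarDir_eq_zero (h v y)
  have h3 : fderiv ℝ (fderiv ℝ f) x u (Complex.I • v)
      = Complex.I • fderiv ℝ (fderiv ℝ f) x u v := by
    rw [← hap, h2, fderiv_fun_const_smul ((hd'.hasFDerivAt).clm_apply
      (hasFDerivAt_const v x)).differentiableAt, ← hap]
    rfl
  rw [dbarDir, hap, hap, hsymm v, hsymm (Complex.I • v), h3, smul_smul, Complex.I_mul_I]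
  simp

theorem contDiff_of_dbarDir_eq_zero [FiniteDimensional ℂ V] {f : V → ℂ} (hf : ContDiff ℝ ∞ f)
    (h : ∀ v x, dbarDir v f x = 0) : ContDiff ℂ ∞ f := by
  rw [contDiff_infty]
  intro n
  induction n generalizing f with
  | zero => exact contDiff_zero.2 hf.continuous
  | succ n ih =>
    have hd := differentiable_of_dbarDir_eq_zero (hf.differentiable (by simp)) h
    rw [Nat.cast_succ, contDiff_succ_iff_fderiv]
    refine ⟨hd, by simp, contDiff_clm_apply_iff.2 fun u => ?_⟩
    have h2 : (fun x => fderiv ℂ f x u) = fun x => fderiv ℝ f x u :=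
      funext fun x => (fderiv_eq_of_differentiable hd x u).symm
    rw [h2]
    exact ih ((hf.fderiv_right (m := ∞) (by simp)).clm_apply contDiff_const)
      (dbarDir_fderiv_apply hf h u)

/-- On forms of degree zero, `∂̄` is given by the antiholomorphic directional derivatives. -/
theorem dbarFun_apply_of_degree_zero {η : V → V [⋀^Fin 0]→L[ℝ] ℂ} {x : V}
    (hη : DifferentiableAt ℝ η x) (m : Fin 1 → V) :
    dbarFun η x m = dbarDir (m 0) (fun y => η y ![]) x := by
  have key : ∀ v m', fderiv ℝ (fun y => η y ![]) x v = fderiv ℝ η x v m' := fun v m' => by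
    have := ((ContinuousAlternatingMap.apply ℝ V ℂ ![]).hasFDerivAt.comp x hη.hasFDerivAt).fderiv
    change fderiv ℝ (⇑(ContinuousAlternatingMap.apply ℝ V ℂ ![]) ∘ η) x v = _
    rw [this, Subsingleton.elim m' ![]]
    rfl
  rw [dbarFun_apply, dbarDir, key _ (Fin.removeNth 0 m), key _ (Fin.removeNth 0 m)]
  simp

/-- A function with vanishing `∂̄` is holomorphic. -/
theorem analyticAt_of_dbarFun_eq_zero [FiniteDimensional ℂ V] {η : V → V [⋀^Fin 0]→L[ℝ] ℂ}
    (hη : ContDiff ℝ ∞ η) (h : dbarFun η = 0) (x : V) : AnalyticAt ℂ (fun y => η y ![]) x := by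
  refine analyticAt_of_contDiff (contDiff_of_dbarDir_eq_zero ?_ fun v y => ?_) x
  · exact (ContinuousAlternatingMap.apply ℝ V ℂ ![]).contDiff.comp hη
  · have := dbarFun_apply_of_degree_zero ((hη.differentiable (by simp)) y) ![v]
    rw [h] at this
    exact this.symm

end CauchyRiemann

/-! ### Maximal cones of a complete smooth fan -/

section FanGeometry

/-- A `ℤ`-basis of the lattice is an `ℝ`-basis of the ambient space. -/
theorem exists_basis_eq_latticeVec {n : ℕ} (b : Module.Basis (Fin n) ℤ (Fin n → ℤ)) :
    ∃ B : Module.Basis (Fin n) ℝ (Fin n → ℝ), ∀ i, B i = latticeVec (b i) := by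
  -- The integral determinant is a unit and stays one in ℝ.
  have h1 : IsUnit ((Pi.basisFun ℤ (Fin n)).det b) := (Pi.basisFun ℤ (Fin n)).isUnit_det b
  have h2 : (Pi.basisFun ℝ (Fin n)).det (fun i => latticeVec (b i))
      = (((Pi.basisFun ℤ (Fin n)).det b : ℤ) : ℝ) := by
    rw [Pi.basisFun_det, Pi.basisFun_det]
    exact (Int.cast_det (Matrix.of fun i => b i)).symm
  have h3 : IsUnit ((Pi.basisFun ℝ (Fin n)).det (fun i => latticeVec (b i))) := by
    rw [h2]
    exact h1.map (Int.castRingHom ℝ)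
  obtain ⟨hl, hs⟩ := (Module.Basis.is_basis_iff_det _).2 h3
  exact ⟨Module.Basis.mk hl hs.ge, fun i => by simp⟩

theorem mem_hull_basis_iff {n : ℕ} (B : Module.Basis (Fin n) ℝ (Fin n → ℝ)) (s : Set (Fin n))
    (x : Fin n → ℝ) :
    x ∈ PointedCone.hull ℝ (B '' s) ↔ ∀ i, 0 ≤ B.repr x i ∧ (i ∉ s → B.repr x i = 0) := by
  constructor
  · intro hx
    induction hx using Submodule.span_induction with
    | mem x hx =>
      obtain ⟨j, hj, rfl⟩ := hx
      intro i
      rw [B.repr_self, Finsupp.single_apply]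
      refine ⟨by split_ifs <;> norm_num, fun hi => if_neg ?_⟩
      rintro rfl
      exact hi hj
    | zero => simp
    | add x y _ _ hx hy =>
      intro i
      rw [map_add, Finsupp.add_apply]
      exact ⟨add_nonneg (hx i).1 (hy i).1, fun hi => by rw [(hx i).2 hi, (hy i).2 hi, add_zero]⟩
    | smul a x _ hx =>
      intro i
      have : B.repr (a • x) i = a.1 * B.repr x i := by
        change B.repr (a.1 • x) i = _
        rw [map_smul]
        rfl
      rw [this]
      exact ⟨mul_nonneg a.2 (hx i).1, fun hi => by rw [(hx i).2 hi, mul_zero]⟩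
  · intro h
    rw [← B.sum_repr x]
    refine Submodule.sum_mem _ fun i _ => ?_
    by_cases hi : i ∈ s
    · exact PointedCone.smul_mem _ (h i).1 (PointedCone.subset_hull ⟨i, hi, rfl⟩)
    · rw [(h i).2 hi, zero_smul]
      exact Submodule.zero_mem _

namespace Fan

variable {n : ℕ} {F : Fan n}

instance : Finite F.MaxCone :=
  (F.finite_cones.subset fun _ h => h.1 :
    {σ : PointedCone ℝ (Fin n → ℝ) | σ ∈ F.cones ∧ coneDim σ = n}.Finite).to_subtype

theorem IsSmooth.exists_basis (h : F.IsSmooth) {σ : PointedCone ℝ (Fin n → ℝ)}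
    (hσ : σ ∈ F.cones) : ∃ (B : Module.Basis (Fin n) ℝ (Fin n → ℝ)) (s : Set (Fin n)),
      σ = PointedCone.hull ℝ (B '' s) := by
  obtain ⟨b, s, rfl⟩ := h σ hσ
  obtain ⟨B, hB⟩ := exists_basis_eq_latticeVec b
  refine ⟨B, s, ?_⟩
  rw [← funext hB]

theorem IsSmooth.isClosed (h : F.IsSmooth) {σ : PointedCone ℝ (Fin n → ℝ)}
    (hσ : σ ∈ F.cones) : IsClosed (σ : Set (Fin n → ℝ)) := by
  obtain ⟨B, s, rfl⟩ := h.exists_basis hσ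
  have hc : ∀ i, Continuous fun x => B.repr x i := fun i =>
    (B.coord i).continuous_of_finiteDimensional
  have : (PointedCone.hull ℝ (B '' s) : Set (Fin n → ℝ))
      = ⋂ i, {x | 0 ≤ B.repr x i} ∩ {x | i ∉ s → B.repr x i = 0} := by
    ext x
    simp only [SetLike.mem_coe, mem_hull_basis_iff, Set.mem_iInter, Set.mem_inter_iff,
      Set.mem_ofPred_eq]
  rw [this]
  refine isClosed_iInter fun i => (isClosed_le continuous_const (hc i)).inter ?_
  by_cases hi : i ∈ s
  · simp [hi]
  · simpa [hi] using isClosed_eq (hc i) continuous_const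

theorem coneDim_eq_iff {σ : PointedCone ℝ (Fin n → ℝ)} :
    coneDim σ = n ↔ Submodule.span ℝ (σ : Set (Fin n → ℝ)) = ⊤ := by
  constructor
  · intro h
    exact Submodule.eq_top_of_finrank_eq (by rw [Module.finrank_fin_fun]; exact h)
  · intro h
    rw [coneDim, h, finrank_top, Module.finrank_fin_fun]

theorem IsSmooth.exists_basis_of_maxCone (h : F.IsSmooth) (σ : F.MaxCone) :
    ∃ B : Module.Basis (Fin n) ℝ (Fin n → ℝ), ∀ x, x ∈ σ.1 ↔ ∀ i, 0 ≤ B.repr x i := by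
  obtain ⟨B, s, hB⟩ := h.exists_basis σ.2.1
  have hs : ∀ i, i ∈ s := by
    intro i
    by_contra hi
    have h1 : Submodule.span ℝ (σ.1 : Set (Fin n → ℝ)) ≤ LinearMap.ker (B.coord i) := by
      refine Submodule.span_le.2 fun x hx => ?_
      rw [hB] at hx
      exact ((mem_hull_basis_iff B s x).1 hx i).2 hi
    rw [coneDim_eq_iff.1 σ.2.2] at h1
    have h2 : B.coord i (B i) = 0 := h1 (Submodule.mem_top (x := B i))
    simp at h2
  refine ⟨B, fun x => ?_⟩
  rw [hB, mem_hull_basis_iff]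
  simp [hs]

/-- A basis of `ℝⁿ` that generates a given maximal cone of a smooth fan. -/
def IsSmooth.basis (h : F.IsSmooth) (σ : F.MaxCone) : Module.Basis (Fin n) ℝ (Fin n → ℝ) :=
  (h.exists_basis_of_maxCone σ).choose

theorem IsSmooth.mem_iff (h : F.IsSmooth) (σ : F.MaxCone) {x : Fin n → ℝ} :
    x ∈ σ.1 ↔ ∀ i, 0 ≤ (h.basis σ).repr x i :=
  (h.exists_basis_of_maxCone σ).choose_spec x

theorem IsSmooth.basis_mem (h : F.IsSmooth) (σ : F.MaxCone) (i : Fin n) : h.basis σ i ∈ σ.1 := by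
  rw [h.mem_iff]
  intro j
  rw [(h.basis σ).repr_self, Finsupp.single_apply]
  split_ifs <;> norm_num

/-- A cone of the fan that contains another cone of the fan has it as a face. -/
theorem isFaceOf_of_le {γ κ : PointedCone ℝ (Fin n → ℝ)} (hγ : γ ∈ F.cones) (hκ : κ ∈ F.cones)
    (h : γ ≤ κ) : γ.IsFaceOf κ := by
  have := (F.inf_isFaceOf γ hγ κ hκ).2
  rwa [inf_eq_left.2 h] at this

theorem inf_mem {γ κ : PointedCone ℝ (Fin n → ℝ)} (hγ : γ ∈ F.cones) (hκ : κ ∈ F.cones) :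
    γ ⊓ κ ∈ F.cones :=
  F.face_mem γ hγ _ (F.inf_isFaceOf γ hγ κ hκ).1

/-- A face that contains a non-negative combination contains every generator occurring with a
positive coefficient. -/
theorem IsSmooth.basis_mem_of_face (h : F.IsSmooth) (σ : F.MaxCone)
    {γ : PointedCone ℝ (Fin n → ℝ)} (hγ : γ.IsFaceOf σ.1) {x : Fin n → ℝ} (hx : x ∈ γ) {i : Fin n}
    (hi : (h.basis σ).repr x i ≠ 0) : h.basis σ i ∈ γ := by
  have hx' := (h.mem_iff σ).1 (hγ.le hx)
  refine hγ.mem_of_sum_smul_mem (c := fun i => (h.basis σ).repr x i) (f := h.basis σ)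
    (h.basis_mem σ) hx' ?_ i (lt_of_le_of_ne (hx' i) hi.symm)
  rwa [(h.basis σ).sum_repr]

/-- Maximal cones are maximal with respect to inclusion. -/
theorem IsSmooth.eq_of_le (h : F.IsSmooth) (κ : F.MaxCone) {γ : PointedCone ℝ (Fin n → ℝ)}
    (hγ : γ ∈ F.cones) (hle : κ.1 ≤ γ) : κ.1 = γ := by
  refine le_antisymm hle fun y hy => ?_
  have hf := isFaceOf_of_le κ.2.1 hγ hle
  set B := h.basis κ
  -- An interior point of κ. A large multiple `M • x` dominates `y` in all coordinates, so it is the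
  -- sum of `y` and a point of κ; as κ is a face of γ, it must contain `y`.
  set x : Fin n → ℝ := ∑ j, B j
  have hx : ∀ j, B.repr x j = 1 := fun j => by
    simp [x, B, map_sum, Finsupp.finsetSum_apply, Finsupp.single_apply]
  set M : ℝ := 1 + ∑ j, |B.repr y j|
  have hM : 0 < M := by positivity
  have hm : ∀ j, B.repr y j ≤ M := fun j => by
    have h1 := Finset.single_le_sum (f := fun j => |B.repr y j|) (fun j _ => abs_nonneg _)
      (Finset.mem_univ j)
    have h2 := le_abs_self (B.repr y j)
    have h3 : |B.repr y j| ≤ ∑ j, |B.repr y j| := h1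
    simp only [M]
    linarith
  have hz : M • x - y ∈ κ.1 := by
    rw [h.mem_iff]
    intro j
    change 0 ≤ B.repr (M • x - y) j
    rw [map_sub, map_smul, Finsupp.sub_apply, Finsupp.smul_apply, hx j, smul_eq_mul, mul_one]
    linarith [hm j]
  refine hf.mem_of_add_mem_right (hle hz) hy ?_
  rw [sub_add_cancel]
  refine PointedCone.smul_mem _ hM.le ?_
  exact Submodule.sum_mem _ fun j _ => h.basis_mem κ j

/-- Locally around a point, each ray starting at it stays in a cone of the fan. -/
theorem IsComplete.exists_mem_add_smul_mem (hc : F.IsComplete) (h : F.IsSmooth)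
    (w u : Fin n → ℝ) : ∃ κ ∈ F.cones, ∃ t : ℝ, 0 < t ∧ w ∈ κ ∧ w + t • u ∈ κ := by
  by_contra! hcon
  -- A cone through `w` is avoided by assumption, any other because it is closed. With finitely many
  -- cones, some small t then avoids them all, against completeness.
  have h1 : ∀ κ ∈ F.cones, ∀ᶠ t : ℝ in 𝓝[>] 0, w + t • u ∉ κ := by
    intro κ hκ
    by_cases hw : w ∈ κ
    · filter_upwards [self_mem_nhdsWithin] with t ht using hcon κ hκ t ht hw
    · have h2 : ContinuousAt (fun t : ℝ => w + t • u) 0 := by fun_prop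
      have h3 : (κ : Set (Fin n → ℝ))ᶜ ∈ 𝓝 (w + (0 : ℝ) • u) := by
        refine (h.isClosed hκ).isOpen_compl.mem_nhds ?_
        simpa using hw
      exact nhdsWithin_le_nhds (h2 h3)
  obtain ⟨t, ht⟩ := ((Filter.eventually_all_finite F.finite_cones).2 h1).exists
  obtain ⟨σ, hσ, hmem⟩ := hc (w + t • u)
  exact ht σ hσ hmem

/-- There are vectors outside finitely many proper subspaces and outside the span of each
lower-dimensional cone. -/
theorem exists_generic (F : Fan n) (T : Finset (Submodule ℝ (Fin n → ℝ))) (hT : ⊤ ∉ T) :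
    ∃ u : Fin n → ℝ, (∀ S ∈ T, u ∉ S) ∧
      ∀ κ ∈ F.cones, u ∈ Submodule.span ℝ (κ : Set (Fin n → ℝ)) → coneDim κ = n := by
  classical
  let T' : Finset (Submodule ℝ (Fin n → ℝ)) :=
    T ∪ (F.finite_cones.toFinset.image fun κ : PointedCone ℝ (Fin n → ℝ) => Submodule.span ℝ (κ : Set (Fin n → ℝ))).erase ⊤
  have h1 : ⊤ ∉ T' := by simp [T', hT]
  have h2 := Subspace.biUnion_ne_univ_of_top_notMem h1
  obtain ⟨u, hu⟩ := (Set.ne_univ_iff_exists_notMem _).1 h2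
  simp only [Set.mem_iUnion, not_exists] at hu
  refine ⟨u, fun S hS => hu S (Finset.mem_union_left _ hS), fun κ hκ hmem => ?_⟩
  by_contra hne
  refine hu _ (Finset.mem_union_right _ (Finset.mem_erase.2 ⟨?_, ?_⟩)) hmem
  · exact fun h => hne (coneDim_eq_iff.2 h)
  · exact Finset.mem_image.2 ⟨κ, F.finite_cones.mem_toFinset.2 hκ, rfl⟩

/-- If a direction is generic, then each point lies in a maximal cone that contains the beginning
of the ray in this direction. -/
theorem IsComplete.exists_maxCone_add_smul_mem (hc : F.IsComplete) (h : F.IsSmooth)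
    (w u : Fin n → ℝ)
    (hu : ∀ κ ∈ F.cones, u ∈ Submodule.span ℝ (κ : Set (Fin n → ℝ)) → coneDim κ = n) :
    ∃ κ : F.MaxCone, ∃ t : ℝ, 0 < t ∧ w ∈ κ.1 ∧ w + t • u ∈ κ.1 := by
  obtain ⟨κ, hκ, t, ht, hw, hwu⟩ := hc.exists_mem_add_smul_mem h w u
  refine ⟨⟨κ, hκ, hu κ hκ ?_⟩, t, ht, hw, hwu⟩
  have h1 : u = t⁻¹ • ((w + t • u) - w) := by
    rw [add_sub_cancel_left, smul_smul, inv_mul_cancel₀ ht.ne', one_smul]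
  rw [h1]
  exact Submodule.smul_mem _ _ (Submodule.sub_mem _ (Submodule.subset_span hwu)
    (Submodule.subset_span hw))

theorem IsComplete.exists_le_maxCone (hc : F.IsComplete) (h : F.IsSmooth)
    {γ : PointedCone ℝ (Fin n → ℝ)} (hγ : γ ∈ F.cones) : ∃ κ : F.MaxCone, γ ≤ κ.1 := by
  classical
  obtain ⟨s, hs⟩ := F.rational γ hγ
  obtain ⟨u, -, hu⟩ := F.exists_generic ∅ (by simp)
  have hmem : ∀ v : s, latticeVec v.1 ∈ γ := fun v => by
    rw [hs]
    exact PointedCone.subset_hull ⟨v.1, v.2, rfl⟩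
  -- The sum of the generators is a relative interior point of γ, so a maximal cone containing it
  -- meets γ in a face containing all generators.
  obtain ⟨κ, t, -, hw, -⟩ := hc.exists_maxCone_add_smul_mem h (∑ v : s, latticeVec v.1) u hu
  refine ⟨κ, ?_⟩
  have h1 : ∀ v : s, latticeVec v.1 ∈ γ ⊓ κ.1 :=
    (F.inf_isFaceOf γ hγ κ.1 κ.2.1).1.mem_of_sum_mem hmem
      ⟨Submodule.sum_mem _ fun v _ => hmem v, hw⟩
  rw [hs]
  refine Submodule.span_le.2 ?_
  rintro _ ⟨v, hv, rfl⟩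
  exact (h1 ⟨v, hv⟩).2

/-- If the rays with `z ρ ≠ 0` lay in no common cone, a minimal such subset would be a primitive
collection with non-zero product, contradicting `z ∈ F.fiber`. -/
theorem IsComplete.exists_mem_component (hc : F.IsComplete) (h : F.IsSmooth) {z : F.Ray → ℂ}
    (hz : z ∈ F.fiber) : ∃ σ : F.MaxCone, z ∈ F.component σ := by
  classical
  have key : ∃ γ ∈ F.cones, ∀ ρ ∈ Finset.univ.filter (fun ρ => z ρ ≠ 0), ρ.1 ≤ γ := by
    by_contra hcon
    obtain ⟨P, hPle, hP⟩ := exists_minimal_le_of_wellFoundedLT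
      (fun P : Finset F.Ray => ¬ ∃ γ ∈ F.cones, ∀ ρ ∈ P, ρ.1 ≤ γ) _ hcon
    have hprim : F.IsPrimitiveCollection P := by
      refine ⟨hP.prop, fun Q hQ => ?_⟩
      by_contra hQ'
      exact hQ.2 (hP.le_of_le hQ' hQ.1)
    refine Finset.prod_ne_zero_iff.2 (fun ρ hρ => ?_) (hz P hprim)
    exact (Finset.mem_filter.1 (hPle hρ)).2
  obtain ⟨γ, hγ, hγS⟩ := key
  obtain ⟨σ, hσ⟩ := hc.exists_le_maxCone h hγ
  refine ⟨σ, fun ρ hρ => ?_⟩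
  by_contra hne
  exact hρ ((hγS ρ (by simpa using hne)).trans hσ)

/-- Across each facet of a maximal cone there is another maximal cone. -/
theorem IsComplete.exists_neighbour (hc : F.IsComplete) (h : F.IsSmooth) (κ : F.MaxCone)
    (i : Fin n) : ∃ κ' : F.MaxCone, h.basis κ i ∉ κ'.1 ∧ ∀ j ≠ i, h.basis κ j ∈ κ'.1 := by
  classical
  set B := h.basis κ with hB
  have hker : LinearMap.ker (B.coord i) ≠ ⊤ := by
    intro h0
    have h2 : B.coord i (B i) = 0 := h0.ge (Submodule.mem_top (x := B i))
    simp at h2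
  obtain ⟨u, hu, hgen⟩ := F.exists_generic {LinearMap.ker (B.coord i)} (by simpa using hker.symm)
  have hu' : B.repr u i ≠ 0 := hu _ (Finset.mem_singleton_self _)
  obtain ⟨v, hv, hgen'⟩ : ∃ v : Fin n → ℝ, B.repr v i < 0 ∧
      ∀ κ ∈ F.cones, v ∈ Submodule.span ℝ (κ : Set (Fin n → ℝ)) → coneDim κ = n := by
    rcases lt_or_gt_of_ne hu' with hlt | hgt
    · exact ⟨u, hlt, hgen⟩
    · refine ⟨-u, ?_, fun κ hκ hm => hgen κ hκ (by simpa using Submodule.neg_mem _ hm)⟩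
      rw [map_neg, Finsupp.neg_apply]
      linarith
  -- A relative interior point of the facet opposite to `B i`. Moving from it along `v`, whose i-th
  -- coordinate is negative, leaves κ at once, while genericity of `v` ensures that the cone entered
  -- is maximal.
  set w : Fin n → ℝ := ∑ j, if j = i then 0 else B j
  have hterm : ∀ j, (if j = i then 0 else B j) ∈ κ.1 := fun j => by
    split_ifs
    · exact Submodule.zero_mem _
    · exact h.basis_mem κ j
  obtain ⟨κ', t, ht, hw, hwv⟩ := hc.exists_maxCone_add_smul_mem h w v hgen'
  have hfacet : ∀ j ≠ i, B j ∈ κ'.1 := fun j hj => by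
    have h1 := (F.inf_isFaceOf κ.1 κ.2.1 κ'.1 κ'.2.1).1.mem_of_sum_mem hterm
      ⟨Submodule.sum_mem _ fun j _ => hterm j, hw⟩ j
    rw [if_neg hj] at h1
    exact h1.2
  refine ⟨κ', fun hi => ?_, hfacet⟩
  have hle : κ.1 ≤ κ'.1 := by
    intro x hx
    rw [← B.sum_repr x]
    refine Submodule.sum_mem _ fun j _ => PointedCone.smul_mem _ ((h.mem_iff κ).1 hx j) ?_
    by_cases hj : j = i
    · exact hj ▸ hi
    · exact hfacet j hj
  rw [← h.eq_of_le κ κ'.2.1 hle, h.mem_iff] at hwv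
  have h2 := hwv i
  rw [← hB] at h2
  have h3 : B.repr w i = 0 := by
    simp only [w, map_sum, Finsupp.finsetSum_apply]
    refine Finset.sum_eq_zero fun j _ => ?_
    split_ifs with hj
    · simp
    · simp [Finsupp.single_apply, hj]
  rw [map_add, map_smul, Finsupp.add_apply, Finsupp.smul_apply, h3, zero_add, smul_eq_mul] at h2
  nlinarith

end Fan

end FanGeometry

/-! ### Rays, common facets, and connecting maximal cones -/

section FanRays

namespace Fan

variable {n : ℕ} {F : Fan n}

theorem mem_hull_singleton_iff {b x : Fin n → ℝ} :
    x ∈ PointedCone.hull ℝ {b} ↔ ∃ t : ℝ, 0 ≤ t ∧ x = t • b := by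
  rw [PointedCone.hull, Submodule.mem_span_singleton]
  constructor
  · rintro ⟨t, rfl⟩
    exact ⟨t.1, t.2, rfl⟩
  · rintro ⟨t, ht, rfl⟩
    exact ⟨⟨t, ht⟩, rfl⟩

theorem IsSmooth.hull_basis_isFaceOf (h : F.IsSmooth) (κ : F.MaxCone) (i : Fin n) :
    (PointedCone.hull ℝ {h.basis κ i}).IsFaceOf κ.1 := by
  set B := h.basis κ
  constructor
  · intro x hx
    obtain ⟨t, ht, rfl⟩ := mem_hull_singleton_iff.1 hx
    exact PointedCone.smul_mem _ ht (h.basis_mem κ i)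
  · intro x y a hx hy ha hxy
    obtain ⟨t, -, hxt⟩ := mem_hull_singleton_iff.1 hxy
    have hx' := (h.mem_iff κ).1 hx
    have hy' := (h.mem_iff κ).1 hy
    refine mem_hull_singleton_iff.2 ⟨B.repr x i, hx' i, B.repr.injective ?_⟩
    ext j
    rw [map_smul, Finsupp.smul_apply, B.repr_self, Finsupp.single_apply, smul_eq_mul]
    split_ifs with hij
    · rw [← hij, mul_one]
    · have h1 := DFunLike.congr_fun (congrArg B.repr hxt) j
      rw [map_add, map_smul, map_smul, B.repr_self, Finsupp.add_apply, Finsupp.smul_apply,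
        Finsupp.smul_apply, Finsupp.single_apply, if_neg hij, smul_eq_mul, smul_zero] at h1
      have h2 := mul_nonneg ha.le (hx' j)
      have h3 : a * B.repr x j = 0 := by
        have := hy' j
        change 0 ≤ B.repr y j at this
        change 0 ≤ a * B.repr x j at h2
        linarith
      rw [mul_zero]
      exact (mul_eq_zero.1 h3).resolve_left ha.ne'

/-- The ray spanned by an element of the basis of a maximal cone. -/
def IsSmooth.ray (h : F.IsSmooth) (κ : F.MaxCone) (i : Fin n) : F.Ray :=
  ⟨PointedCone.hull ℝ {h.basis κ i}, F.face_mem κ.1 κ.2.1 _ (h.hull_basis_isFaceOf κ i), by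
    rw [coneDim, PointedCone.hull, Submodule.span_span_of_tower]
    exact finrank_span_singleton ((h.basis κ).ne_zero i)⟩

theorem IsSmooth.ray_le_iff (h : F.IsSmooth) (κ : F.MaxCone) (i : Fin n)
    (γ : PointedCone ℝ (Fin n → ℝ)) : (h.ray κ i).1 ≤ γ ↔ h.basis κ i ∈ γ := by
  change PointedCone.hull ℝ {h.basis κ i} ≤ γ ↔ _
  rw [PointedCone.hull, Submodule.span_singleton_le_iff_mem]

theorem IsSmooth.ray_injective (h : F.IsSmooth) (κ : F.MaxCone) :
    Function.Injective (h.ray κ) := by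
  intro i j hij
  have h1 : h.basis κ i ∈ PointedCone.hull ℝ {h.basis κ j} :=
    (h.ray_le_iff κ i _).1 (congrArg Subtype.val hij).le
  obtain ⟨t, -, ht⟩ := mem_hull_singleton_iff.1 h1
  by_contra hne
  have h2 := DFunLike.congr_fun (congrArg (h.basis κ).repr ht) i
  simp [Finsupp.single_apply, Ne.symm hne] at h2

/-- The ray is a face of κ, so it contains each basis vector that occurs in one of its points; its
dimension leaves room for only one. -/
theorem IsSmooth.exists_ray_eq (h : F.IsSmooth) (κ : F.MaxCone) {ρ : F.Ray} (hρ : ρ.1 ≤ κ.1) :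
    ∃ i, h.ray κ i = ρ := by
  have hface := isFaceOf_of_le ρ.2.1 κ.2.1 hρ
  obtain ⟨x, hx, hx0⟩ : ∃ x ∈ ρ.1, x ≠ 0 := by
    by_contra! hcon
    have h1 : Submodule.span ℝ (ρ.1 : Set (Fin n → ℝ)) = ⊥ :=
      Submodule.span_eq_bot.2 hcon
    have h2 := ρ.2.2
    rw [coneDim, h1, finrank_bot] at h2
    exact zero_ne_one h2
  obtain ⟨i, hi⟩ : ∃ i, (h.basis κ).repr x i ≠ 0 := by
    by_contra! hcon
    exact hx0 ((h.basis κ).repr.map_eq_zero_iff.1 (Finsupp.ext hcon))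
  have hbi := h.basis_mem_of_face κ hface hx hi
  refine ⟨i, Subtype.ext (le_antisymm ((h.ray_le_iff κ i _).2 hbi) fun y hy => ?_)⟩
  refine mem_hull_singleton_iff.2
    ⟨(h.basis κ).repr y i, (h.mem_iff κ).1 (hρ hy) i, (h.basis κ).repr.injective ?_⟩
  ext j
  rw [map_smul, Finsupp.smul_apply, (h.basis κ).repr_self, Finsupp.single_apply, smul_eq_mul]
  split_ifs with hij
  · rw [← hij, mul_one]
  rw [mul_zero]
  by_contra hne
  have hbj := h.basis_mem_of_face κ hface hy hne
  obtain ⟨c, hc⟩ := (finrank_eq_one_iff_of_nonzero'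
    (⟨h.basis κ i, Submodule.subset_span hbi⟩ : Submodule.span ℝ (ρ.1 : Set (Fin n → ℝ)))
    (fun h0 => (h.basis κ).ne_zero i (congrArg Subtype.val h0))).1 ρ.2.2
    ⟨h.basis κ j, Submodule.subset_span hbj⟩
  have h1 : c • h.basis κ i = h.basis κ j := congrArg Subtype.val hc
  have h2 := DFunLike.congr_fun (congrArg (h.basis κ).repr h1) j
  simp [Finsupp.single_apply, hij] at h2

theorem component_inf_eq (κ κ' : F.MaxCone) :
    F.component κ ⊓ F.component κ'
      = ⨅ ρ ∈ {ρ : F.Ray | ρ.1 ≤ κ.1 ∧ ρ.1 ≤ κ'.1}ᶜ,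
        LinearMap.ker (LinearMap.proj ρ : (F.Ray → ℂ) →ₗ[ℂ] ℂ) := by
  ext z
  simp only [Submodule.mem_inf, Submodule.mem_iInf, LinearMap.mem_ker, LinearMap.proj_apply,
    Set.mem_compl_iff, Set.mem_ofPred_eq, not_and_or]
  constructor
  · rintro ⟨h1, h2⟩ ρ (hρ | hρ)
    · exact h1 ρ hρ
    · exact h2 ρ hρ
  · exact fun h => ⟨fun ρ hρ => h ρ (Or.inl hρ), fun ρ hρ => h ρ (Or.inr hρ)⟩

/-- Turns the codimension-one condition in `forms` into a count of common rays. -/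
theorem finrank_component_inf (κ κ' : F.MaxCone) :
    Module.finrank ℂ (F.component κ ⊓ F.component κ' : Submodule ℂ (F.Ray → ℂ))
      = {ρ : F.Ray | ρ.1 ≤ κ.1 ∧ ρ.1 ≤ κ'.1}.ncard := by
  classical
  rw [component_inf_eq, (LinearMap.iInfKerProjEquiv ℂ (fun _ : F.Ray => ℂ)
    (I := {ρ : F.Ray | ρ.1 ≤ κ.1 ∧ ρ.1 ≤ κ'.1}) disjoint_compl_right
    (by simp)).finrank_eq, Module.finrank_fintype_fun_eq_card, Set.ncard_eq_toFinset_card',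
    Set.toFinset_card]

/-- The components of two maximal cones with a common facet meet in codimension one. -/
theorem IsSmooth.finrank_component_inf_add_one (h : F.IsSmooth) (κ κ' : F.MaxCone) (i : Fin n)
    (hi : h.basis κ i ∉ κ'.1) (hj : ∀ j ≠ i, h.basis κ j ∈ κ'.1) :
    Module.finrank ℂ (F.component κ ⊓ F.component κ' : Submodule ℂ (F.Ray → ℂ)) + 1 = n := by
  rw [finrank_component_inf]
  have h1 : {ρ : F.Ray | ρ.1 ≤ κ.1 ∧ ρ.1 ≤ κ'.1} = h.ray κ '' {i}ᶜ := by
    ext ρ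
    constructor
    · rintro ⟨h1, h2⟩
      obtain ⟨j, rfl⟩ := h.exists_ray_eq κ h1
      refine ⟨j, ?_, rfl⟩
      rintro rfl
      exact hi ((h.ray_le_iff κ j _).1 h2)
    · rintro ⟨j, hji, rfl⟩
      exact ⟨(h.ray_le_iff κ j _).2 (h.basis_mem κ j), (h.ray_le_iff κ j _).2 (hj j hji)⟩
  rw [h1, Set.ncard_image_of_injective _ (h.ray_injective κ), Set.ncard_compl,
    Set.ncard_singleton, Nat.card_fin]
  have := i.pos
  omega

theorem IsProjective.exists_linear (hp : F.IsProjective) :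
    ∃ (ψ : (Fin n → ℝ) → ℝ) (ℓ : F.MaxCone → (Fin n → ℝ) →ₗ[ℝ] ℝ),
      ∀ κ : F.MaxCone, (∀ v ∈ κ.1, ℓ κ v = ψ v) ∧ ∀ v ∉ κ.1, ℓ κ v < ψ v := by
  obtain ⟨ψ, hψ⟩ := hp
  choose m hm hm' using fun κ : F.MaxCone => hψ κ.1 κ.2.1 κ.2.2
  have h1 : ∀ κ v, (∑ i, ((m κ i : ℤ) : ℝ) • (LinearMap.proj i : (Fin n → ℝ) →ₗ[ℝ] ℝ)) v
      = ∑ i, (m κ i : ℝ) * v i := fun κ v => by simp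
  refine ⟨ψ, fun κ => ∑ i, ((m κ i : ℤ) : ℝ) • LinearMap.proj i, fun κ =>
    ⟨fun v hv => ?_, fun v hv => ?_⟩⟩
  · rw [h1, hm κ v hv]
  · rw [h1]
    exact hm' κ v hv

/-- An interior point of the maximal cone `τ`, moved so far in the direction of the face `δ` that
all its coordinates along `δ` with respect to each maximal cone containing `δ` are non-negative. -/
theorem IsSmooth.exists_interior_point (h : F.IsSmooth) (τ : F.MaxCone)
    {δ : PointedCone ℝ (Fin n → ℝ)} (hδ : δ ≤ τ.1) :
    ∃ y : Fin n → ℝ, (∀ κ : F.MaxCone, y ∈ κ.1 → κ = τ) ∧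
      ∀ κ : F.MaxCone, δ ≤ κ.1 → ∀ i, h.basis κ i ∈ δ → 0 ≤ (h.basis κ).repr y i := by
  classical
  have := Fintype.ofFinite F.MaxCone
  let y0 : Fin n → ℝ := ∑ j, h.basis τ j
  let g : F.MaxCone → Fin n → Fin n → ℝ := fun κ i => if h.basis κ i ∈ δ then h.basis κ i else 0
  have hg : ∀ κ i, g κ i ∈ δ := fun κ i => by
    simp only [g]
    split_ifs with hi
    · exact hi
    · exact Submodule.zero_mem _
  -- For every maximal cone containing δ, `w` has coordinate at least 1 along each basis vector in
  -- δ, so adding `M • w` outweighs any negative coordinate of `y0` there.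
  let w : Fin n → ℝ := ∑ κ, ∑ i, g κ i
  have hw : w ∈ δ := Submodule.sum_mem _ fun κ _ => Submodule.sum_mem _ fun i _ => hg κ i
  let M : ℝ := ∑ κ, ∑ i, |(h.basis κ).repr y0 i|
  have hM : 0 ≤ M := Finset.sum_nonneg fun κ _ => Finset.sum_nonneg fun i _ => abs_nonneg _
  refine ⟨y0 + M • w, fun κ hκ => ?_, fun κ hκ i hi => ?_⟩
  · have hface := (F.inf_isFaceOf τ.1 τ.2.1 κ.1 κ.2.1).1
    have h0 : y0 ∈ τ.1 := Submodule.sum_mem _ fun j _ => h.basis_mem τ j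
    have h1 : M • w ∈ τ.1 := PointedCone.smul_mem _ hM (hδ hw)
    have h2 := hface.mem_of_add_mem_left h0 h1 ⟨Submodule.add_mem _ h0 h1, hκ⟩
    have h3 : ∀ j, h.basis τ j ∈ τ.1 ⊓ κ.1 := hface.mem_of_sum_mem (h.basis_mem τ) h2
    have hle : τ.1 ≤ κ.1 := fun x hx => by
      rw [← (h.basis τ).sum_repr x]
      exact Submodule.sum_mem _ fun j _ =>
        PointedCone.smul_mem _ ((h.mem_iff τ).1 hx j) (h3 j).2
    exact Subtype.ext (h.eq_of_le τ κ.2.1 hle).symm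
  · have hnn : ∀ x ∈ δ, 0 ≤ (h.basis κ).repr x i := fun x hx => (h.mem_iff κ).1 (hκ hx) i
    have h1 : 1 ≤ (h.basis κ).repr w i := by
      have e : (h.basis κ).repr w i = ∑ κ', ∑ j, (h.basis κ).repr (g κ' j) i := by
        simp only [w, map_sum, Finsupp.finsetSum_apply]
      have e1 : (h.basis κ).repr (g κ i) i = 1 := by
        simp [g, hi]
      rw [e, ← e1]
      refine le_trans ?_ (Finset.single_le_sum
        (f := fun κ' => ∑ j, (h.basis κ).repr (g κ' j) i)
        (fun κ' _ => Finset.sum_nonneg fun j _ => hnn _ (hg κ' j)) (Finset.mem_univ κ))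
      exact Finset.single_le_sum (f := fun j => (h.basis κ).repr (g κ j) i)
        (fun j _ => hnn _ (hg κ j)) (Finset.mem_univ i)
    have h2 : |(h.basis κ).repr y0 i| ≤ M := by
      refine le_trans ?_ (Finset.single_le_sum
        (f := fun κ' => ∑ j, |(h.basis κ').repr y0 j|)
        (fun κ' _ => Finset.sum_nonneg fun j _ => abs_nonneg _) (Finset.mem_univ κ))
      exact Finset.single_le_sum (f := fun j => |(h.basis κ).repr y0 j|)
        (fun j _ => abs_nonneg _) (Finset.mem_univ i)
    rw [map_add, map_smul, Finsupp.add_apply, Finsupp.smul_apply, smul_eq_mul]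
    have h3 := neg_abs_le ((h.basis κ).repr y0 i)
    nlinarith

/-- Any two maximal cones of a projective fan are connected, through maximal cones containing their
intersection, by crossing facets. -/
theorem IsProjective.induction_maxCone (hp : F.IsProjective) (hc : F.IsComplete) (h : F.IsSmooth)
    (σ τ : F.MaxCone) (P : F.MaxCone → Prop) (hτ : P τ)
    (hstep : ∀ κ κ' : F.MaxCone, σ.1 ⊓ τ.1 ≤ κ.1 → σ.1 ⊓ τ.1 ≤ κ'.1 →
      Module.finrank ℂ (F.component κ ⊓ F.component κ' : Submodule ℂ (F.Ray → ℂ)) + 1 = n →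
      P κ' → P κ) : P σ := by
  by_contra hσ
  obtain ⟨ψ, ℓ, hℓ⟩ := hp.exists_linear
  obtain ⟨y, hyτ, hy⟩ := h.exists_interior_point τ (δ := σ.1 ⊓ τ.1) inf_le_right
  -- Among the cones violating `P`, take one whose linear piece is largest at `y`; a neighbour with
  -- a larger value must then satisfy `P`.
  obtain ⟨κ, ⟨hδκ, hPκ⟩, hmax⟩ := Set.exists_max_image
    {κ : F.MaxCone | σ.1 ⊓ τ.1 ≤ κ.1 ∧ ¬ P κ} (fun κ => ℓ κ y) (Set.toFinite _)
    ⟨σ, inf_le_left, hσ⟩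
  have hyκ : y ∉ κ.1 := fun hmem => hPκ (hyτ κ hmem ▸ hτ)
  obtain ⟨i, hi⟩ : ∃ i, (h.basis κ).repr y i < 0 := by
    by_contra! hcon
    exact hyκ ((h.mem_iff κ).2 hcon)
  obtain ⟨κ', hi', hj'⟩ := hc.exists_neighbour h κ i
  -- The crossed facet still contains σ ∩ τ: the basis vector left behind has a negative coordinate
  -- in `y`, whereas those in σ ∩ τ have non-negative ones.
  have hδκ' : σ.1 ⊓ τ.1 ≤ κ'.1 := by
    intro x hx
    have hface := isFaceOf_of_le (inf_mem σ.2.1 τ.2.1) κ.2.1 hδκ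
    rw [← (h.basis κ).sum_repr x]
    refine Submodule.sum_mem _ fun j _ => ?_
    by_cases hj : (h.basis κ).repr x j = 0
    · rw [hj, zero_smul]
      exact Submodule.zero_mem _
    · refine PointedCone.smul_mem _ ((h.mem_iff κ).1 (hδκ hx) j) (hj' j ?_)
      rintro rfl
      exact absurd (hy κ hδκ j (h.basis_mem_of_face κ hface hx hj)) (not_le.2 hi)
  have hrank := h.finrank_component_inf_add_one κ κ' i hi' hj'
  -- The difference of the two pieces vanishes on the common facet and, by strict convexity, is
  -- negative at the i-th basis vector; `y` lies on the other side.
  have hlt : ℓ κ y < ℓ κ' y := by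
    have h1 : ∀ j, j ≠ i → (ℓ κ' - ℓ κ) (h.basis κ j) = 0 := fun j hj => by
      rw [LinearMap.sub_apply, (hℓ κ').1 _ (hj' j hj), (hℓ κ).1 _ (h.basis_mem κ j), sub_self]
    have h2 : (ℓ κ' - ℓ κ) (h.basis κ i) < 0 := by
      rw [LinearMap.sub_apply, (hℓ κ).1 _ (h.basis_mem κ i)]
      linarith [(hℓ κ').2 _ hi']
    have h3 : (ℓ κ' - ℓ κ) y = (h.basis κ).repr y i * (ℓ κ' - ℓ κ) (h.basis κ i) := by
      conv_lhs => rw [← (h.basis κ).sum_repr y]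
      rw [map_sum, Finset.sum_eq_single i (fun j _ hj => by rw [map_smul, h1 j hj, smul_zero])
        (fun hn => absurd (Finset.mem_univ i) hn), map_smul, smul_eq_mul]
    have h4 := mul_pos_of_neg_of_neg hi h2
    rw [← h3, LinearMap.sub_apply] at h4
    linarith
  refine absurd (hmax κ' ⟨hδκ', fun hP' => hPκ ?_⟩) (not_le.2 hlt)
  exact hstep κ κ' hδκ hδκ' hrank hP'

end Fan

end FanRays

/-! ### Extension of forms to ℂ^d and exactness -/

section Resolution

theorem pullback_pullback {V W U : Type*} [NormedAddCommGroup V] [NormedSpace ℂ V]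
    [NormedAddCommGroup W] [NormedSpace ℂ W] [NormedAddCommGroup U] [NormedSpace ℂ U] (q : ℕ)
    (L : W →L[ℂ] V) (M : U →L[ℂ] W) (η : Form V q) :
    pullback q M (pullback q L η) = pullback q (L.comp M) η := rfl

theorem pullback_id {V : Type*} [NormedAddCommGroup V] [NormedSpace ℂ V] (q : ℕ) (η : Form V q) :
    pullback q (ContinuousLinearMap.id ℂ V) η = η := rfl

section Correction

variable {V W U : Type*} [NormedAddCommGroup V] [NormedSpace ℂ V]
  [NormedAddCommGroup W] [NormedSpace ℂ W] [NormedAddCommGroup U] [NormedSpace ℂ U] {q : ℕ}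

theorem add_add_neg_one_smul (Ω θ : Form V q) : Ω + (θ + (-1 : ℂ) • Ω) = θ := by
  refine Subtype.ext (funext fun x => ContinuousAlternatingMap.ext fun m => ?_)
  change Ω.1 x m + (θ.1 x m + (-1 : ℂ) * Ω.1 x m) = θ.1 x m
  ring

theorem add_neg_one_smul_self (Ω : Form V q) : Ω + (-1 : ℂ) • Ω = 0 := by
  refine Subtype.ext (funext fun x => ContinuousAlternatingMap.ext fun m => ?_)
  change Ω.1 x m + (-1 : ℂ) * Ω.1 x m = 0
  ring

/-- The form `Ω`, corrected such that its restriction along `i` becomes `θ`. -/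
def correction (i : W →L[ℂ] V) (p : V →L[ℂ] W) (Ω : Form V q) (θ : Form W q) : Form V q :=
  Ω + pullback q p (θ + (-1 : ℂ) • pullback q i Ω)

theorem pullback_correction {i : W →L[ℂ] V} {p : V →L[ℂ] W}
    (h : p.comp i = ContinuousLinearMap.id ℂ W) (Ω : Form V q) (θ : Form W q) :
    pullback q i (correction i p Ω θ) = θ := by
  rw [correction, map_add, pullback_pullback, h, pullback_id, add_add_neg_one_smul]

/-- Along `j` the correcting term factors through `a`, where θ and Ω already agree; so components
treated earlier are undisturbed. -/
theorem pullback_correction_of_comp_eq {X : Type*} [NormedAddCommGroup X] [NormedSpace ℂ X]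
    {i : W →L[ℂ] V} {p : V →L[ℂ] W} {j : U →L[ℂ] V} {a : X →L[ℂ] W} {b : U →L[ℂ] X}
    (h : p.comp j = a.comp b) {Ω : Form V q} {θ : Form W q}
    (hθ : pullback q a θ = pullback q a (pullback q i Ω)) :
    pullback q j (correction i p Ω θ) = pullback q j Ω := by
  rw [correction, map_add, pullback_pullback, h, ← pullback_pullback,
    map_add (pullback q a), map_smul, hθ, add_neg_one_smul_self, map_zero, add_zero]

theorem dbar_correction (i : W →L[ℂ] V) (p : V →L[ℂ] W) {Ω : Form V q} {θ : Form W q}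
    (hΩ : dbar V q Ω = 0) (hθ : dbar W q θ = 0) : dbar V q (correction i p Ω θ) = 0 := by
  rw [correction, map_add, dbar_pullback, map_add, map_smul, dbar_pullback, hΩ, hθ, map_zero,
    smul_zero, add_zero, map_zero, add_zero]

end Correction

namespace Fan

variable {n : ℕ} {F : Fan n}

/-- The restrictions of a form on `X` to two components agree on the whole intersection of these
components, whatever its dimension. -/
theorem restrictLeft_eq_restrictRight (hc : F.IsComplete) (h : F.IsSmooth) (hp : F.IsProjective)
    {q : ℕ} (η : F.forms q) (σ τ : F.MaxCone) :
    F.restrictLeft q σ τ (η.1 σ) = F.restrictRight q σ τ (η.1 τ) := by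
  refine hp.induction_maxCone hc h σ τ
    (fun κ => ∀ hκ : F.component σ ⊓ F.component τ ≤ F.component κ,
      pullback q (LinearMap.toContinuousLinearMap (Submodule.inclusion hκ)) (η.1 κ)
        = F.restrictRight q σ τ (η.1 τ)) (fun _ => rfl) ?_ inf_le_left
  intro κ κ' _ hκ' hrank hP hκ
  -- A ray contained in both σ and τ lies in σ ∩ τ and hence in κ'. So all comparisons along the
  -- chain can be restricted to X_σ ∩ X_τ.
  have hle : F.component σ ⊓ F.component τ ≤ F.component κ' := by
    rintro z ⟨h1, h2⟩ ρ hρ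
    by_cases h3 : ρ.1 ≤ σ.1
    · exact h2 ρ fun h4 => hρ ((le_inf h3 h4).trans hκ')
    · exact h1 ρ h3
  rw [← hP hle]
  exact congrArg (pullback q (LinearMap.toContinuousLinearMap
    (Submodule.inclusion (le_inf hκ hle)))) (η.2 κ κ' hrank)

/-- The inclusion of a component of `X`. -/
def incl (σ : F.MaxCone) : F.component σ →L[ℂ] (F.Ray → ℂ) := (F.component σ).subtypeL

open Classical in
/-- The coordinate projection onto a component of `X`. -/
def componentProj (σ : F.MaxCone) : (F.Ray → ℂ) →L[ℂ] F.component σ :=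
  LinearMap.toContinuousLinearMap
    { toFun := fun z => ⟨fun ρ => if ρ.1 ≤ σ.1 then z ρ else 0, fun _ hρ => if_neg hρ⟩
      map_add' := fun z w => by
        ext ρ
        change (if ρ.1 ≤ σ.1 then z ρ + w ρ else 0)
          = (if ρ.1 ≤ σ.1 then z ρ else 0) + (if ρ.1 ≤ σ.1 then w ρ else 0)
        split_ifs <;> simp
      map_smul' := fun c z => by
        ext ρ
        change (if ρ.1 ≤ σ.1 then c * z ρ else 0) = c * (if ρ.1 ≤ σ.1 then z ρ else 0)
        split_ifs <;> simp }

open Classical in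
theorem componentProj_apply (σ : F.MaxCone) (z : F.Ray → ℂ) (ρ : F.Ray) :
    (componentProj σ z).1 ρ = if ρ.1 ≤ σ.1 then z ρ else 0 := rfl

theorem componentProj_comp_incl (σ : F.MaxCone) :
    (componentProj σ).comp (incl σ) = ContinuousLinearMap.id ℂ (F.component σ) := by
  ext z ρ
  change (componentProj σ z.1).1 ρ = z.1 ρ
  rw [componentProj_apply]
  split_ifs with hρ
  · rfl
  · exact (z.2 ρ hρ).symm

/-- Coordinate projections only set coordinates to zero, so they preserve every coordinate subspace.
-/
theorem exists_componentProj_comp_incl_eq (σ τ : F.MaxCone) :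
    ∃ p : F.component τ →L[ℂ] (F.component σ ⊓ F.component τ : Submodule ℂ (F.Ray → ℂ)),
      (componentProj σ).comp (incl τ)
        = (LinearMap.toContinuousLinearMap (Submodule.inclusion inf_le_left)).comp p := by
  have hmem : ∀ z : F.component τ, (componentProj σ z.1).1 ∈ F.component σ ⊓ F.component τ := by
    refine fun z => ⟨(componentProj σ z.1).2, fun ρ hρ => ?_⟩
    rw [componentProj_apply]
    split_ifs
    · exact z.2 ρ hρ
    · rfl
  refine ⟨LinearMap.toContinuousLinearMap (LinearMap.codRestrict _
    ((incl σ).comp ((componentProj σ).comp (incl τ))).toLinearMap hmem), ?_⟩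
  ext z ρ
  rfl

/-- Each form on `X` extends to the ambient space, and each closed form has a closed extension. -/
theorem exists_extension (hc : F.IsComplete) (h : F.IsSmooth) (hp : F.IsProjective) {q : ℕ}
    (η : F.forms q) : ∃ Ω : Form (F.Ray → ℂ) q, (∀ σ, pullback q (incl σ) Ω = η.1 σ) ∧
      (F.dbarX q η = 0 → dbar _ q Ω = 0) := by
  classical
  have := Fintype.ofFinite F.MaxCone
  suffices hS : ∀ S : Finset F.MaxCone, ∃ Ω : Form (F.Ray → ℂ) q,
      (∀ σ ∈ S, pullback q (incl σ) Ω = η.1 σ) ∧ (F.dbarX q η = 0 → dbar _ q Ω = 0) by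
    obtain ⟨Ω, h1, h2⟩ := hS Finset.univ
    exact ⟨Ω, fun σ => h1 σ (Finset.mem_univ σ), h2⟩
  intro S
  induction S using Finset.induction_on with
  | empty => exact ⟨0, by simp, fun _ => map_zero _⟩
  | insert σ S _ ih =>
    obtain ⟨Ω, hΩ, hcl⟩ := ih
    refine ⟨correction (incl σ) (componentProj σ) Ω (η.1 σ), fun τ hτ => ?_, fun h0 =>
      dbar_correction _ _ (hcl h0) (congrFun (congrArg Subtype.val h0) σ)⟩
    by_cases hτS : τ ∈ S
    · obtain ⟨p, hpe⟩ := exists_componentProj_comp_incl_eq σ τ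
      refine (pullback_correction_of_comp_eq hpe ?_).trans (hΩ τ hτS)
      refine (restrictLeft_eq_restrictRight hc h hp η σ τ).trans ?_
      rw [← hΩ τ hτS]
      rfl
    · obtain rfl := (Finset.mem_insert.1 hτ).resolve_right hτS
      exact pullback_correction (componentProj_comp_incl τ) Ω (η.1 τ)

theorem ofHolo_apply (f : F.holo) (σ : F.MaxCone) (x : F.component σ)
    (m : Fin 0 → F.component σ) :
    ((F.ofHolo f).1 σ).1 x m = f.1 ⟨x.1, F.component_subset_fiber σ x.2⟩ := rfl

theorem ofHolo_injective (hc : F.IsComplete) (h : F.IsSmooth) :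
    Function.Injective F.ofHolo := by
  intro f g hfg
  refine Subtype.ext (funext fun z => ?_)
  obtain ⟨σ, hσ⟩ := hc.exists_mem_component h z.2
  have h1 := congrArg (fun η : F.forms 0 => (η.1 σ).1 ⟨z.1, hσ⟩ ![]) hfg
  exact h1

theorem dbarX_ofHolo (f : F.holo) : F.dbarX 0 (F.ofHolo f) = 0 := by
  refine Subtype.ext (funext fun σ => Subtype.ext (funext fun x =>
    ContinuousAlternatingMap.ext fun m => ?_))
  have hd : Differentiable ℝ ((F.ofHolo f).1 σ).1 :=
    ((F.ofHolo f).1 σ).2.1.differentiable (by simp)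
  refine (dbarFun_apply_of_degree_zero (hd x) m).trans ?_
  obtain ⟨g, hg, hfg⟩ := f.2 ⟨x.1, F.component_subset_fiber σ x.2⟩
  have hcont : Continuous (fun y : F.component σ =>
      (⟨y.1, F.component_subset_fiber σ y.2⟩ : F.fiber)) := by fun_prop
  have h1 : (fun y : F.component σ => ((F.ofHolo f).1 σ).1 y ![])
      =ᶠ[𝓝 x] fun y => g y.1 := hcont.continuousAt.eventually hfg
  have h2 : DifferentiableAt ℂ (fun y : F.component σ => g y.1) x :=
    (hg.comp_of_eq ((F.component σ).subtypeL.analyticAt x) rfl).differentiableAt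
  have h3 := dbarDir_of_differentiableAt h2 (m 0)
  rw [dbarDir, ← h1.fderiv_eq] at h3
  exact h3

theorem exact_ofHolo_dbarX (hc : F.IsComplete) (h : F.IsSmooth) (hp : F.IsProjective) :
    Function.Exact F.ofHolo (F.dbarX 0) := by
  intro η
  constructor
  · intro h0
    obtain ⟨Ω, hΩ, hcl⟩ := exists_extension hc h hp η
    have h1 : dbarFun Ω.1 = 0 := congrArg Subtype.val (hcl h0)
    -- The closed extension is an entire function on ℂ^d, so a holomorphic function on X arises as a
    -- global restriction.
    refine ⟨⟨fun z => Ω.1 z.1 ![], fun z =>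
      ⟨_, analyticAt_of_dbarFun_eq_zero Ω.2.1 h1 z.1, Filter.Eventually.of_forall fun _ => rfl⟩⟩,
      Subtype.ext (funext fun σ => Subtype.ext (funext fun x =>
        ContinuousAlternatingMap.ext fun m => ?_))⟩
    rw [ofHolo_apply, ← hΩ σ]
    change Ω.1 x.1 ![] = Ω.1 x.1 (⇑(incl σ) ∘ m)
    rw [Subsingleton.elim ![] (⇑(incl σ) ∘ m)]
  · rintro ⟨f, rfl⟩
    exact dbarX_ofHolo f

theorem exact_dbarX_dbarX (hc : F.IsComplete) (h : F.IsSmooth) (hp : F.IsProjective) (q : ℕ) :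
    Function.Exact (F.dbarX q) (F.dbarX (q + 1)) := by
  intro η
  constructor
  · intro h0
    obtain ⟨Ω, hΩ, hcl⟩ := exists_extension hc h hp η
    obtain ⟨u, hu, hd⟩ := exists_dbarFun_eq Ω.2 (congrArg Subtype.val (hcl h0))
    -- Restrictions of a single ambient primitive are automatically compatible.
    refine ⟨⟨fun σ => pullback q (incl σ) ⟨u, hu⟩, fun σ τ _ => rfl⟩,
      Subtype.ext (funext fun σ => ?_)⟩
    have h1 : dbar (F.Ray → ℂ) q ⟨u, hu⟩ = Ω := Subtype.ext hd
    change dbar (F.component σ) q (pullback q (incl σ) ⟨u, hu⟩) = η.1 σ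
    rw [dbar_pullback, h1, hΩ]
  · rintro ⟨θ, rfl⟩
    refine Subtype.ext (funext fun σ => Subtype.ext ?_)
    exact dbarFun_dbarFun (θ.1 σ).2.1

end Fan

end Resolution

end LogLG

end

open LogLG in
/-- Let `Σ` be a complete smooth projective fan in `ℝⁿ` and `X` the corresponding singular fibre.
Then `0 → 𝒪(X) → 𝒜^{0,0}(X) → 𝒜^{0,1}(X) → 𝒜^{0,2}(X) → ⋯`, with differential `∂̄`, is exact. -/
theorem mainTheorem12 (n : ℕ) (F : Fan n) (hcomplete : F.IsComplete) (hsmooth : F.IsSmooth)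
    (hprojective : F.IsProjective) :
    Function.Injective F.ofHolo ∧
      Function.Exact F.ofHolo (F.dbarX 0) ∧
      ∀ q : ℕ, Function.Exact (F.dbarX q) (F.dbarX (q + 1)) :=
  ⟨Fan.ofHolo_injective hcomplete hsmooth,
    Fan.exact_ofHolo_dbarX hcomplete hsmooth hprojective,
    Fan.exact_dbarX_dbarX hcomplete hsmooth hprojective⟩
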